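/- Let $\pi$ be a discrete group such that (1) the centraliser of every nontrivial element $g\in\pi$ is cyclic and (2) $\mathrm{cd}(\pi\times\pi)>\mathrm{cd}(\pi)$, where $\mathrm{cd}(G)\in\{0,1,2,\dots\}\cup\{\infty\}$ denotes the cohomological dimension of a group $G$, i.e. the supremum of all $n$ with $H^n(G,A)\neq 0$ for some $\mathbf Z[G]$-module $A$. (For example, $\pi$ may be the fundamental group of a connected aspherical finite cell complex satisfying (1) and (2).) View the group ring $\mathbf Z[\pi]$ as a left $\mathbf Z[\pi\times\pi]$-module via $(g,h)\cdot a=gah^{-1}$, let $I=\ker(\epsilon:\mathbf Z[\pi]\to\mathbf Z)$ be the augmentation ideal, and for $k\ge 0$ let $I^k=I\otimes_{\mathbf Z}\cdots\otimes_{\mathbf Z}I$ ($k$ factors, $I^0=\mathbf Z$) with the diagonal action of $\pi\times\pi$. Let $\mathfrak v\in H^1(\pi\times\pi,I)$ be the canonical class, i.e. the class of the extension $0\to I\to\mathbf Z[\pi]\xrightarrow{\epsilon}\mathbf Z\to 0$, represented by the crossed homomorphism $(g,h)\mapsto gh^{-1}-1$, and let $\mathfrak v^k\in H^k(\pi\times\pi,I^k)$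 be its $k$-fold cup power ($\mathfrak v^0=1$). Then $n=\mathrm{cd}(\pi\times\pi)$ is finite and $$\mathfrak v^{\,n-1}\neq 0\in H^{n-1}(\pi\times\pi,I^{n-1}).$$ -/

import Mathlib

noncomputable section

universe u

namespace CanonicalClass

open CategoryTheory MonoidalCategory TensorProduct

/-- The cohomological dimension of a group `G` (over `ℤ`): the supremum, in `ℕ∞`, of the degrees
`n` such that `Hⁿ(G, A) ≠ 0` for some `ℤ[G]`-module `A`. -/
def cd (G : Type) [Group G] : ℕ∞ :=
  sSup {d : ℕ∞ | ∃ n : ℕ, d = n ∧ ∃ A : Rep.{0} ℤ G, Nontrivial (groupCohomology A n)}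

section Cup

variable {k G : Type u} [CommRing k] [Group G] {A B : Rep.{u} k G} {p q : ℕ}

/-- The cup product of inhomogeneous cochains,
`(f ∪ g)(x₁, …, x_{p+q}) = f(x₁, …, x_p) ⊗ (x₁ ⋯ x_p) • g(x_{p+1}, …, x_{p+q})`,
with the diagonal action on `A ⊗ B`. -/
def cupCochain (f : (Fin p → G) → A) (g : (Fin q → G) → B) :
    (Fin (p + q) → G) → (A ⊗ B : Rep.{u} k G) :=
  fun x => f (fun i => x (Fin.castAdd q i)) ⊗ₜ[k]
    B.ρ (Fin.partialProd (fun i => x (Fin.castAdd q i)) (Fin.last p))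
      (g fun j => x (Fin.natAdd p j))

theorem cupCochain_zero_left (g : (Fin q → G) → B) (x : Fin (p + q) → G) :
    cupCochain (fun _ : Fin p → G => (0 : A)) g x = 0 :=
  TensorProduct.zero_tmul _ _

theorem cupCochain_zero_right (f : (Fin p → G) → A) (x : Fin (p + q) → G) :
    cupCochain f (fun _ : Fin q → G => (0 : B)) x = 0 := by
  unfold cupCochain
  rw [map_zero]
  exact TensorProduct.tmul_zero _ _

theorem head_contract_castAdd (x : Fin (p + q + 1) → G) (j : Fin p) :
    (fun i : Fin p => Fin.contractNth (Fin.castAdd (q + 1) j : Fin (p + q + 1)) (· * ·) x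
      (Fin.castAdd q i)) =
    Fin.contractNth j.castSucc (· * ·)
      (fun i : Fin (p + 1) => x (Fin.cast (by omega) (Fin.castAdd q i))) := by
  funext i
  rcases lt_trichotomy (i : ℕ) j with h | h | h
  · rw [Fin.contractNth_apply_of_lt _ _ _ _ (by simpa using h),
      Fin.contractNth_apply_of_lt _ _ _ _ (by simpa using h)]; rfl
  · rw [Fin.contractNth_apply_of_eq _ _ _ _ (by simpa using h),
      Fin.contractNth_apply_of_eq _ _ _ _ (by simpa using h)]; rfl
  · rw [Fin.contractNth_apply_of_gt _ _ _ _ (by simpa using h),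
      Fin.contractNth_apply_of_gt _ _ _ _ (by simpa using h)]; rfl

theorem tail_contract_castAdd (x : Fin (p + q + 1) → G) (j : Fin p) :
    (fun i : Fin q => Fin.contractNth (Fin.castAdd (q + 1) j : Fin (p + q + 1)) (· * ·) x
      (Fin.natAdd p i)) =
      (fun i : Fin q => x (Fin.cast (by omega) (Fin.natAdd (p + 1) i))) := by
  funext i
  rw [Fin.contractNth_apply_of_gt _ _ _ _ (by simp; omega)]
  congr 1; ext; simp; omega

theorem head_contract_natAdd (x : Fin (p + q + 1) → G) (j : Fin (q + 1)) :
    (fun i : Fin p => Fin.contractNth (Fin.natAdd p j : Fin (p + q + 1)) (· * ·) x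
      (Fin.castAdd q i)) =
    (fun i : Fin p => x (Fin.castAdd (q + 1) i)) := by
  funext i
  rw [Fin.contractNth_apply_of_lt _ _ _ _ (by simp; omega)]
  rfl

theorem tail_contract_natAdd (x : Fin (p + q + 1) → G) (j : Fin (q + 1)) :
    (fun i : Fin q => Fin.contractNth (Fin.natAdd p j : Fin (p + q + 1)) (· * ·) x
      (Fin.natAdd p i)) =
    Fin.contractNth j (· * ·) (fun i : Fin (q + 1) => x (Fin.natAdd p i)) := by
  funext i
  rcases lt_trichotomy (i : ℕ) j with h | h | h
  · rw [Fin.contractNth_apply_of_lt _ _ _ _ (by simpa using h),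
      Fin.contractNth_apply_of_lt _ _ _ _ (by simpa using h)]; rfl
  · rw [Fin.contractNth_apply_of_eq _ _ _ _ (by simpa using h),
      Fin.contractNth_apply_of_eq _ _ _ _ (by simpa using h)]; rfl
  · rw [Fin.contractNth_apply_of_gt _ _ _ _ (by simpa using h),
      Fin.contractNth_apply_of_gt _ _ _ _ (by simpa using h)]; rfl

/-- The Leibniz rule `d(f ∪ g) = df ∪ g + (-1)ᵖ f ∪ dg`. -/
theorem cupCochain_d (f : (Fin p → G) → A) (g : (Fin q → G) → B)
    (x : Fin (p + q + 1) → G) :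
    inhomogeneousCochains.d (A ⊗ B) (p + q) (cupCochain f g) x =
      cupCochain (inhomogeneousCochains.d A p f) g
          (fun i => x (Fin.cast (by omega) i)) +
        (-1 : k) ^ p • cupCochain (q := q + 1) f (inhomogeneousCochains.d B q g) x := by
  have key : ∀ j : Fin p, cupCochain f g (Fin.contractNth (Fin.castAdd (q + 1) j : Fin (p + q + 1)) (· * ·) x) =
      f (Fin.contractNth j.castSucc (· * ·)
      (fun i : Fin (p + 1) => x (Fin.cast (by omega) (Fin.castAdd q i)))) ⊗ₜ[k]
        B.ρ (Fin.partialProd (fun i : Fin (p + 1) => x (Fin.cast (by omega) (Fin.castAdd q i))) (Fin.last (p + 1)))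
        (g (fun i : Fin q => x (Fin.cast (by omega) (Fin.natAdd (p + 1) i)))) := by
    intro j
    unfold cupCochain
    rw [head_contract_castAdd, tail_contract_castAdd, Fin.partialProd_contractNth, Function.comp_apply,
      show j.castSucc.succ.succAbove (Fin.last p) = Fin.last (p + 1) from
        Fin.succAbove_ne_last_last (by simp [Fin.ext_iff]; omega)]
  have keyB : ∀ j : Fin (q + 1), cupCochain f g (Fin.contractNth (Fin.natAdd p j : Fin (p + q + 1)) (· * ·) x) =
      f (fun i : Fin p => x (Fin.castAdd (q + 1) i)) ⊗ₜ[k]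
        B.ρ (Fin.partialProd (fun i : Fin p => x (Fin.castAdd (q + 1) i)) (Fin.last p))
        (g (Fin.contractNth j (· * ·) (fun i : Fin (q + 1) => x (Fin.natAdd p i)))) := by
    intro j
    unfold cupCochain
    rw [head_contract_natAdd, tail_contract_natAdd]
  rw [inhomogeneousCochains.d_hom_apply]
  rw [show (∑ j : Fin (p + q + 1), (-1 : k) ^ ((j : ℕ) + 1) •
      cupCochain f g (Fin.contractNth j (· * ·) x)) = _ from
      Fin.sum_univ_add (a := p) (b := q + 1) (fun j : Fin (p + (q + 1)) => (-1 : k) ^ ((j : ℕ) + 1) •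
      cupCochain f g (Fin.contractNth j (· * ·) x))]
  simp only [key, keyB]
  have h0 : (A ⊗ B : Rep.{u} k G).ρ (x 0) (cupCochain f g fun i => x i.succ) =
      A.ρ (x 0) (f fun i : Fin p => x (Fin.cast (by omega) (Fin.castAdd q i.succ))) ⊗ₜ[k]
        B.ρ (Fin.partialProd (fun i : Fin (p + 1) => x (Fin.cast (by omega) (Fin.castAdd q i))) (Fin.last (p + 1)))
        (g (fun i : Fin q => x (Fin.cast (by omega) (Fin.natAdd (p + 1) i)))) := by
    unfold cupCochain
    rw [← Fin.succ_last, Fin.partialProd_succ', map_mul]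
    have e : (fun j : Fin q => x (Fin.natAdd p j).succ) = (fun i : Fin q => x (Fin.cast (by omega) (Fin.natAdd (p + 1) i))) := by
      funext i; congr 1; ext; simp; omega
    rw [e]
    rfl
  have h1 : cupCochain (inhomogeneousCochains.d A p f) g (fun i => x (Fin.cast (by omega) i)) =
     (inhomogeneousCochains.d A p f) (fun i : Fin (p + 1) => x (Fin.cast (by omega) (Fin.castAdd q i))) ⊗ₜ[k]
        B.ρ (Fin.partialProd (fun i : Fin (p + 1) => x (Fin.cast (by omega) (Fin.castAdd q i))) (Fin.last (p + 1)))
        (g (fun i : Fin q => x (Fin.cast (by omega) (Fin.natAdd (p + 1) i)))) := rfl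
  have h2 : cupCochain (q := q + 1) f (inhomogeneousCochains.d B q g) x = 
      f (fun i : Fin p => x (Fin.castAdd (q + 1) i)) ⊗ₜ[k]
        B.ρ (Fin.partialProd (fun i : Fin p => x (Fin.castAdd (q + 1) i)) (Fin.last p))
        (inhomogeneousCochains.d B q g (fun i : Fin (q + 1) => x (Fin.natAdd p i))) := rfl
  have h3 : Fin.contractNth (Fin.last p) (· * ·) (fun i : Fin (p + 1) => x (Fin.cast (by omega) (Fin.castAdd q i)))
      = (fun i : Fin p => x (Fin.castAdd (q + 1) i)) := by
    funext i
    rw [Fin.contractNth_apply_of_lt _ _ _ _ (by simp)]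
    rfl
  have h4 : (fun i : Fin q => x (Fin.natAdd p i.succ)) =
      (fun i : Fin q => x (Fin.cast (by omega) (Fin.natAdd (p + 1) i))) := by
    funext i; congr 1; ext; simp; omega
  have h5 : Fin.partialProd (fun i : Fin (p + 1) => x (Fin.cast (by omega) (Fin.castAdd q i))) (Fin.last (p + 1))
      = Fin.partialProd (fun i : Fin p => x (Fin.castAdd (q + 1) i)) (Fin.last p) * x (Fin.natAdd p (0 : Fin (q + 1))) := by
    rw [← Fin.succ_last, Fin.partialProd_succ, ← Fin.partialProd_init]
    rfl
  rw [h0, h1, h2, inhomogeneousCochains.d_hom_apply, inhomogeneousCochains.d_hom_apply,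
    Fin.sum_univ_castSucc (n := p), h3, h4]
  simp only [TensorProduct.add_tmul, TensorProduct.tmul_add, map_add, map_sum,
    TensorProduct.sum_tmul, TensorProduct.tmul_sum, map_smul, TensorProduct.tmul_smul,
    ← TensorProduct.smul_tmul', h5, map_mul, Module.End.mul_apply, Fin.val_castAdd,
    Fin.val_natAdd, Fin.val_castSucc, Fin.val_last]
  have h6 : ∀ (S : Fin (q + 1) → (A ⊗ B : Rep.{u} k G)),
      ∑ j : Fin (q + 1), (-1 : k) ^ (p + (j : ℕ) + 1) • S j =
        (-1 : k) ^ p • ∑ j : Fin (q + 1), (-1 : k) ^ ((j : ℕ) + 1) • S j := by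
    intro S
    rw [Finset.smul_sum]
    refine Finset.sum_congr rfl fun j _ => ?_
    rw [smul_smul, ← pow_add, add_assoc]
  have h7 : ∀ a b c e : (A ⊗ B : Rep.{u} k G),
      a + (b + (-1 : k) ^ p • c) = a + (b + (-1 : k) ^ (p + 1) • e) + (-1 : k) ^ p • (e + c) := by
    intro a b c e
    rw [pow_succ, mul_neg_one, neg_smul, smul_add]
    abel
  exact (congrArg _ (congrArg _ (h6 _))).trans (h7 _ _ _ _)

theorem d_cupCochain_eq_zero (f : (Fin p → G) → A) (g : (Fin q → G) → B)
    (hf : inhomogeneousCochains.d A p f = 0) (hg : inhomogeneousCochains.d B q g = 0) :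
    inhomogeneousCochains.d (A ⊗ B) (p + q) (cupCochain f g) = 0 := by
  funext x
  rw [cupCochain_d, hf, hg]
  exact (congrArg₂ _ (cupCochain_zero_left _ _)
    ((congrArg _ (cupCochain_zero_right _ _)).trans (smul_zero _))).trans (add_zero _)

/-- The cochain underlying a cocycle. -/
def cochain (a : groupCohomology.cocycles A p) : (Fin p → G) → A :=
  groupCohomology.iCocycles A p a

theorem d_cochain (a : groupCohomology.cocycles A p) :
    inhomogeneousCochains.d A p (cochain a) = 0 := by
  have := ConcreteCategory.congr_hom
    ((groupCohomology.inhomogeneousCochains A).iCycles_d p (p + 1)) a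
  rw [groupCohomology.inhomogeneousCochains.d_def] at this
  exact this

theorem cochain_mk (f : (Fin p → G) → A) (h : inhomogeneousCochains.d A p f = 0) :
    cochain (groupCohomology.cocyclesMk f h) = f :=
  groupCohomology.iCocycles_mk f h

theorem cochain_injective : Function.Injective (cochain (A := A) (p := p)) :=
  (ModuleCat.mono_iff_injective (groupCohomology.iCocycles A p)).1 inferInstance

/-- A cocycle has zero class iff it is a coboundary (zero in degree `0`). -/
theorem π_eq_zero_iff (a : groupCohomology.cocycles A p) :
    groupCohomology.π A p a = 0 ↔ a = 0 ∨ ∃ m, ∃ hm : m + 1 = p, ∃ h : (Fin m → G) → A,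
      ∀ x, cochain a x = inhomogeneousCochains.d A m h (fun i => x (Fin.cast hm i)) := by
  have ex : ∀ i, (ComplexShape.up ℕ).prev p = i → (groupCohomology.π A p a = 0 ↔
      ∃ h, groupCohomology.toCocycles A i p h = a) := by
    intro i hi
    have h1 : (ShortComplex.mk (groupCohomology.toCocycles A i p) (groupCohomology.π A p)
        (by exact HomologicalComplex.toCycles_comp_homologyπ _ _ _)).Exact :=
      ShortComplex.exact_of_g_is_cokernel _ (HomologicalComplex.homologyIsCokernel _ _ _ hi)
    rw [ShortComplex.moduleCat_exact_iff] at h1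
    refine ⟨fun h => h1 a h, ?_⟩
    rintro ⟨h, rfl⟩
    exact ConcreteCategory.congr_hom (HomologicalComplex.toCycles_comp_homologyπ
      (groupCohomology.inhomogeneousCochains A) i p) h
  have hd : ∀ i (h : (groupCohomology.inhomogeneousCochains A).X i),
      cochain (groupCohomology.toCocycles A i p h) =
        (groupCohomology.inhomogeneousCochains A).d i p h := fun i h =>
    ConcreteCategory.congr_hom (HomologicalComplex.toCycles_i
      (groupCohomology.inhomogeneousCochains A) i p) h
  cases p with
  | zero =>
    rw [ex 0 (by simp)]
    constructor
    · rintro ⟨h, rfl⟩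
      refine Or.inl (cochain_injective ?_)
      rw [hd, HomologicalComplex.shape _ _ _ (by simp)]
      exact (map_zero (groupCohomology.iCocycles A 0).hom).symm
    · rintro (rfl | ⟨m, hm, -⟩)
      · exact ⟨0, map_zero _⟩
      · omega
  | succ p =>
    rw [ex p (by simp)]
    constructor
    · rintro ⟨h, rfl⟩
      refine Or.inr ⟨p, rfl, h, fun x => ?_⟩
      rw [hd, groupCohomology.inhomogeneousCochains.d_def]
      rfl
    · rintro (rfl | ⟨m, hm, h, H⟩)
      · exact ⟨0, map_zero _⟩
      obtain rfl : m = p := by omega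
      refine ⟨h, cochain_injective ?_⟩
      rw [hd, groupCohomology.inhomogeneousCochains.d_def]
      exact (funext H).symm

/-- The cup product of two cocycles. -/
def cupCocycle (a : groupCohomology.cocycles A p) (b : groupCohomology.cocycles B q) :
    groupCohomology.cocycles (A ⊗ B) (p + q) :=
  groupCohomology.cocyclesMk (cupCochain (cochain a) (cochain b))
    (d_cupCochain_eq_zero _ _ (d_cochain a) (d_cochain b))

theorem π_surjective : Function.Surjective (groupCohomology.π A p) :=
  fun y => groupCohomology_induction_on y fun x => ⟨x, rfl⟩

/-- The cup product `Hᵖ(G, A) × H^q(G, B) → H^{p+q}(G, A ⊗ B)`, computed on representing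
cocycles; by `cup_π` it does not depend on the representatives. -/
def cup (a : groupCohomology A p) (b : groupCohomology B q) :
    groupCohomology (A ⊗ B) (p + q) :=
  groupCohomology.π (A ⊗ B) (p + q)
    (cupCocycle (Function.surjInv π_surjective a) (Function.surjInv π_surjective b))

theorem π_cupCocycle_left (a : groupCohomology.cocycles A p) (b : groupCohomology.cocycles B q)
    (ha : groupCohomology.π A p a = 0) :
    groupCohomology.π (A ⊗ B) (p + q) (cupCocycle a b) = 0 := by
  rw [π_eq_zero_iff] at ha ⊢
  rcases ha with rfl | ⟨m, rfl, h, H⟩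
  · refine Or.inl (cochain_injective ?_)
    rw [cupCocycle, cochain_mk]
    funext x
    have h0 : ∀ {C : Rep.{u} k G} {r : ℕ} (y : Fin r → G),
      cochain (0 : groupCohomology.cocycles C r) y = 0 := fun {C r} y =>
        congrFun (map_zero (groupCohomology.iCocycles C r).hom) y
    rw [h0, cupCochain, h0]
    exact TensorProduct.zero_tmul _ _
  · refine Or.inr ⟨m + q, by omega, cupCochain h (cochain b), fun x => ?_⟩
    rw [cupCocycle, cochain_mk, cupCochain_d, d_cochain]
    have : cochain a = inhomogeneousCochains.d A m h := funext H
    rw [this]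
    refine (add_zero _).symm.trans (congrArg₂ _ rfl ?_)
    exact ((congrArg _ (cupCochain_zero_right _ _)).trans (smul_zero _)).symm

theorem π_cupCocycle_right (a : groupCohomology.cocycles A p) (b : groupCohomology.cocycles B q)
    (hb : groupCohomology.π B q b = 0) :
    groupCohomology.π (A ⊗ B) (p + q) (cupCocycle a b) = 0 := by
  rw [π_eq_zero_iff] at hb ⊢
  rcases hb with rfl | ⟨m, rfl, h, H⟩
  · refine Or.inl (cochain_injective ?_)
    rw [cupCocycle, cochain_mk]
    funext x
    have h0 : ∀ {C : Rep.{u} k G} {r : ℕ} (y : Fin r → G),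
      cochain (0 : groupCohomology.cocycles C r) y = 0 := fun {C r} y =>
        congrFun (map_zero (groupCohomology.iCocycles C r).hom) y
    rw [h0, cupCochain, h0, map_zero]
    exact TensorProduct.tmul_zero _ _
  · refine Or.inr ⟨p + m, by omega, (-1 : k) ^ p • cupCochain (cochain a) h, fun x => ?_⟩
    have : cochain b = inhomogeneousCochains.d B m h := funext H
    rw [cupCocycle, cochain_mk, this]
    have e := congrFun (map_smul (inhomogeneousCochains.d (A ⊗ B) (p + m)).hom ((-1 : k) ^ p)
      (cupCochain (cochain a) h)) x
    refine Eq.trans ?_ e.symm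
    change _ = (-1 : k) ^ p • (inhomogeneousCochains.d (A ⊗ B) (p + m)) _ x
    rw [cupCochain_d, d_cochain, smul_add, smul_smul, ← mul_pow, neg_one_mul, neg_neg, one_pow,
      one_smul]
    refine (zero_add _).symm.trans (congrArg₂ _ ?_ rfl)
    exact ((congrArg _ (cupCochain_zero_left _ _)).trans (smul_zero _)).symm

theorem cup_π (a : groupCohomology.cocycles A p) (b : groupCohomology.cocycles B q) :
    cup (groupCohomology.π A p a) (groupCohomology.π B q b) =
      groupCohomology.π (A ⊗ B) (p + q) (cupCocycle a b) := by
  unfold cup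
  set a₁ := Function.surjInv π_surjective (groupCohomology.π A p a)
  set b₁ := Function.surjInv π_surjective (groupCohomology.π B q b)
  have ha : groupCohomology.π A p (a₁ - a) = 0 := by
    rw [map_sub, sub_eq_zero]; exact Function.surjInv_eq π_surjective _
  have hb : groupCohomology.π B q (b₁ - b) = 0 := by
    rw [map_sub, sub_eq_zero]; exact Function.surjInv_eq π_surjective _
  have hs : ∀ {C : Rep.{u} k G} {r : ℕ} (y z : groupCohomology.cocycles C r) (t : Fin r → G),
      cochain (y - z) t = cochain y t - cochain z t := fun {C r} y z t =>
        congrFun (map_sub (groupCohomology.iCocycles C r).hom y z) t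
  have key : cupCocycle a₁ b₁ - cupCocycle a b = cupCocycle (a₁ - a) b₁ + cupCocycle a (b₁ - b) := by
    apply cochain_injective
    funext x
    rw [hs]
    refine Eq.trans ?_ (congrFun (map_add (groupCohomology.iCocycles (A ⊗ B) (p + q)).hom _ _) x).symm
    change _ = cochain (cupCocycle (a₁ - a) b₁) x + cochain (cupCocycle a (b₁ - b)) x
    simp only [cupCocycle, cochain_mk, cupCochain, hs, map_sub, TensorProduct.sub_tmul, TensorProduct.tmul_sub]
    exact (sub_add_sub_cancel _ _ _).symm
  rw [← sub_eq_zero, ← map_sub, key, map_add, π_cupCocycle_left _ _ ha, π_cupCocycle_right _ _ hb,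
    add_zero]

end Cup


section Canonical

variable (π : Type) [Group π]

/-- The action `(g, h) • a = g a h⁻¹` of `π × π` on the set `π`. -/
abbrev twoSidedAction : MulAction (π × π) π where
  smul x a := x.1 * a * x.2⁻¹
  one_smul a := by change 1 * a * 1⁻¹ = a; group
  mul_smul x y a := by
    change x.1 * y.1 * a * (x.2 * y.2)⁻¹ = x.1 * (y.1 * a * y.2⁻¹) * x.2⁻¹
    group

/-- The group ring `ℤ[π]` as a `ℤ[π × π]`-module, `(g, h) • a = g a h⁻¹`. -/
abbrev groupRing : Rep.{0} ℤ (π × π) :=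
  letI := twoSidedAction π
  Rep.ofMulAction ℤ (π × π) π

/-- The augmentation `ε : ℤ[π] → ℤ`, the sum of the coefficients. -/
def augmentation : MonoidAlgebra ℤ π →ₗ[ℤ] ℤ :=
  (MonoidAlgebra.lift ℤ ℤ π (1 : π →* ℤ)).toLinearMap

theorem groupRing_single (x : π × π) (a : π) (r : ℤ) :
    (groupRing π).ρ x (MonoidAlgebra.single a r) =
      MonoidAlgebra.single (x.1 * a * x.2⁻¹) r := by
  let _ := twoSidedAction π
  exact Representation.ofMulAction_single x a r

theorem augmentation_ρ (x : π × π) (m : MonoidAlgebra ℤ π) :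
    augmentation π ((groupRing π).ρ x m) = augmentation π m := by
  induction m using MonoidAlgebra.induction_linear with
  | zero => simp
  | add f g hf hg => rw [map_add, map_add, map_add, hf, hg]
  | single a r => rw [groupRing_single]; simp [augmentation]

/-- The augmentation ideal `I = ker ε` as a `ℤ[π × π]`-submodule of `ℤ[π]`. -/
def augIdeal : Rep.{0} ℤ (π × π) :=
  Rep.subrepresentation (groupRing π) (LinearMap.ker (augmentation π)) fun x m hm => by
    rw [Submodule.mem_comap, LinearMap.mem_ker, augmentation_ρ]; exact hm

/-- The tensor powers `Iⁿ = I ⊗ ⋯ ⊗ I` over `ℤ` with the diagonal action; `I⁰ = ℤ`. -/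
def augIdealPow : ℕ → Rep.{0} ℤ (π × π)
  | 0 => 𝟙_ (Rep.{0} ℤ (π × π))
  | n + 1 => augIdealPow n ⊗ augIdeal π

/-- The crossed homomorphism `(g, h) ↦ gh⁻¹ - 1` from `π × π` to `I`. -/
def canonicalCochain (x : Fin 1 → π × π) : augIdeal π :=
  ⟨MonoidAlgebra.single ((x 0).1 * (x 0).2⁻¹) 1 - MonoidAlgebra.single 1 1, by
    simp [augmentation]⟩

theorem d_canonicalCochain :
    inhomogeneousCochains.d (augIdeal π) 1 (canonicalCochain π) = 0 := by
  funext x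
  rw [inhomogeneousCochains.d_hom_apply]
  apply Subtype.ext
  have hρ : ((augIdeal π).ρ (x 0) (canonicalCochain π fun i => x i.succ)).1 =
      MonoidAlgebra.single ((x 0).1 * ((x 1).1 * (x 1).2⁻¹) * (x 0).2⁻¹) 1 -
        MonoidAlgebra.single ((x 0).1 * 1 * (x 0).2⁻¹) 1 := by
    rw [← groupRing_single π (x 0), ← groupRing_single π (x 0), ← map_sub]
    rfl
  have h0 : (canonicalCochain π (Fin.contractNth 0 (· * ·) x)).1 =
      MonoidAlgebra.single ((x 0).1 * ((x 1).1 * (x 1).2⁻¹) * (x 0).2⁻¹) 1 -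
        MonoidAlgebra.single 1 1 := by
    rw [show (x 0).1 * ((x 1).1 * (x 1).2⁻¹) * (x 0).2⁻¹ =
      (x 0).1 * (x 1).1 * ((x 0).2 * (x 1).2)⁻¹ by group]
    rfl
  have h1 : (canonicalCochain π (Fin.contractNth 1 (· * ·) x)).1 =
      MonoidAlgebra.single ((x 0).1 * 1 * (x 0).2⁻¹) 1 - MonoidAlgebra.single 1 1 := by
    rw [mul_one]
    rfl
  rw [Fin.sum_univ_two]
  simp only [Fin.val_zero, Fin.val_one, zero_add, pow_one, one_add_one_eq_two, neg_one_sq,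
    neg_smul]
  erw [one_smul ℤ, one_smul ℤ]
  change _ + (-(canonicalCochain π (Fin.contractNth 0 (· * ·) x)).1 +
    (canonicalCochain π (Fin.contractNth 1 (· * ·) x)).1) = 0
  rw [h0, h1]
  refine (congrArg (· + _) hρ).trans ?_
  abel

/-- The canonical class `𝔳 ∈ H¹(π × π, I)`, the class of the extension `0 → I → ℤ[π] → ℤ → 0`:
in the bar resolution it is represented by the crossed homomorphism `(g, h) ↦ gh⁻¹ - 1`. -/
def canonicalClass : groupCohomology (augIdeal π) 1 :=
  groupCohomology.π (augIdeal π) 1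
    (groupCohomology.cocyclesMk (canonicalCochain π) (d_canonicalCochain π))

/-- The unit `1 ∈ H⁰(G, ℤ)`. -/
def unitClass (G : Type) [Group G] : groupCohomology (𝟙_ (Rep.{0} ℤ G)) 0 :=
  groupCohomology.π _ 0 (groupCohomology.cocyclesMk (fun _ => (1 : ℤ)) (by
    funext x
    rw [inhomogeneousCochains.d_hom_apply]
    simp
    rfl))

/-- The cup powers `𝔳ⁿ ∈ Hⁿ(π × π, Iⁿ)`, with `𝔳⁰ = 1` and `𝔳ⁿ⁺¹ = 𝔳ⁿ ∪ 𝔳`. -/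
def canonicalClassPow : (n : ℕ) → groupCohomology (augIdealPow π n) n
  | 0 => unitClass (π × π)
  | n + 1 => cup (canonicalClassPow n) (canonicalClass π)

end Canonical

end CanonicalClass

end

/-! Write G = π × π and P = ℤ[π]. The sequence 0 → N → Hom(P, N) → Hom(I, N) → 0 shifts dimension:
if H^{r+1}(G, Hom(P, N)) = 0, every class in H^{r+1}(G, N) is the contraction of 𝔳 ∪ y for some y ∈
H^r(G, Hom(I, N)) (`AugmentedModule.exists_eq_d_add`). Iterating with Hom(I, N) in place of N
extracts further factors 𝔳. If 𝔳^{n-1} = 0 and the iteration can be carried out n - 1 times from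
degree n, then Hⁿ(G, A) = 0 for every A (`AugmentedTower.subsingleton_of_isCoboundary_V`),
contradicting cd(G) = n.

The obstructions vanish by Shapiro's lemma. As a permutation module P has stabilizers isomorphic to
π, so the first step works because n > cd(π). Later steps need H^{n-s}(G, Hom(P, Hom(I, N))) = 0 for
0 < s < n - 1. This reduces to the stabilizer of a point a, over which I has the permuted basis x -
a (x ≠ a). The stabilizers of these elements are isomorphic to centralisers of the nontrivial
elements xa⁻¹. These are cyclic, and infinite because cd(π) is finite, so their cohomology vanishes
in all degrees n - s ≥ 2 (`subsingleton_homRep_homRep`).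

Finiteness of cd(G) comes from the same machine, pulled back along (g, h) ↦ (g, 1). There the power
of exponent cd(π) + 1 is inflated from π, hence zero, and the stabilizers are 1 × π. This gives
cd(G) ≤ 2 cd(π). -/

noncomputable section

universe u

namespace CanonicalClass

open CategoryTheory MonoidalCategory TensorProduct

/-! ### Cocycles, coboundaries and change of group. -/

section Cochains

variable {k G H : Type u} [CommRing k] [Group G] [Group H] {n : ℕ}

/-- If `Hⁿ⁺¹(G, A) = 0` then every `(n + 1)`-cocycle is a coboundary. -/
theorem exists_d_eq_of_subsingleton {A : Rep.{u} k G}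
    [hA : Subsingleton (groupCohomology A (n + 1))] (f : (Fin (n + 1) → G) → A)
    (hf : inhomogeneousCochains.d A (n + 1) f = 0) :
    ∃ h : (Fin n → G) → A, inhomogeneousCochains.d A n h = f := by
  rcases (π_eq_zero_iff (groupCohomology.cocyclesMk f hf)).1 (Subsingleton.elim _ _) with
    h | ⟨m, hm, h, H⟩
  · refine ⟨0, ?_⟩
    have h' := congrArg cochain h
    rw [cochain_mk] at h'
    rw [h', map_zero]
    exact (map_zero (groupCohomology.iCocycles A (n + 1)).hom).symm
  · obtain rfl : m = n := by omega
    rw [cochain_mk] at H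
    exact ⟨h, (funext H).symm⟩

theorem subsingleton_of_exists_d_eq {A : Rep.{u} k G}
    (hA : ∀ f : (Fin (n + 1) → G) → A, inhomogeneousCochains.d A (n + 1) f = 0 →
      ∃ h : (Fin n → G) → A, inhomogeneousCochains.d A n h = f) :
    Subsingleton (groupCohomology A (n + 1)) := by
  refine subsingleton_of_forall_eq 0 fun y => ?_
  obtain ⟨a, rfl⟩ := π_surjective y
  obtain ⟨h, hh⟩ := hA (cochain a) (d_cochain a)
  exact (π_eq_zero_iff a).2 (Or.inr ⟨n, rfl, h, fun x => (congrFun hh x).symm⟩)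

/-- The differential commutes with maps of cochains that are compatible with a group
homomorphism. -/
theorem d_map (θ : H →* G) {A : Rep.{u} k G} {B : Rep.{u} k H} (φ : A →ₗ[k] B)
    (hφ : ∀ h a, φ (A.ρ (θ h) a) = B.ρ h (φ a)) (f : (Fin n → G) → A) (x : Fin (n + 1) → H) :
    inhomogeneousCochains.d B n (fun y => φ (f fun i => θ (y i))) x =
      φ (inhomogeneousCochains.d A n f fun i => θ (x i)) := by
  rw [inhomogeneousCochains.d_hom_apply, inhomogeneousCochains.d_hom_apply, map_add, map_sum, hφ]
  congr 1
  refine Finset.sum_congr rfl fun j _ => ?_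
  rw [map_smul]
  congr 3
  exact Fin.comp_contractNth (· * ·) (· * ·) (fun a b => map_mul θ a b) j x

theorem d_res (θ : H →* G) {A : Rep.{u} k G} (f : (Fin n → G) → A) :
    inhomogeneousCochains.d (Rep.res θ A) n (fun y => f fun i => θ (y i)) =
      fun x => inhomogeneousCochains.d A n f fun i => θ (x i) :=
  funext fun x => d_map θ (B := Rep.res θ A) LinearMap.id (fun _ _ => rfl) f x

theorem d_comp_linearMap {A B : Rep.{u} k G} (φ : A →ₗ[k] B)
    (hφ : ∀ g a, φ (A.ρ g a) = B.ρ g (φ a)) (f : (Fin n → G) → A) :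
    inhomogeneousCochains.d B n (fun y => φ (f y)) =
      fun x => φ (inhomogeneousCochains.d A n f x) :=
  funext fun x => d_map (MonoidHom.id G) φ hφ f x

theorem partialProd_map (θ : H →* G) (x : Fin n → H) (i : Fin (n + 1)) :
    Fin.partialProd (fun j => θ (x j)) i = θ (Fin.partialProd x i) := by
  induction i using Fin.induction with
  | zero => simp
  | succ i ih => rw [Fin.partialProd_succ, Fin.partialProd_succ, ih, map_mul]

/-- Cup products of cochains commute with restriction along a group homomorphism. -/
theorem cupCochain_res (θ : H →* G) {A B : Rep.{u} k G} {p q : ℕ} (f : (Fin p → G) → A)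
    (g : (Fin q → G) → B) (x : Fin (p + q) → H) :
    cupCochain (A := Rep.res θ A) (B := Rep.res θ B) (fun y => f fun i => θ (y i))
        (fun y => g fun i => θ (y i)) x =
      (cupCochain f g (fun i => θ (x i)) : A ⊗[k] B) := by
  unfold cupCochain
  rw [partialProd_map θ (fun i => x (Fin.castAdd q i))]
  rfl

/-- A cohomology group vanishes if it does after transport along a group isomorphism. -/
theorem subsingleton_of_mulEquiv (e : G ≃* H) (A : Rep.{u} k G)
    (h : Subsingleton (groupCohomology (Rep.res e.symm.toMonoidHom A) n)) :
    Subsingleton (groupCohomology A n) :=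
  (groupCohomology.mapIso (A := Rep.res e.symm.toMonoidHom A) (B := A) e (LinearEquiv.refl k A)
    (fun g => by ext; simp [Rep.res]) n).toLinearEquiv.toEquiv.subsingleton

/-- Shapiro's lemma, for vanishing of cohomology. -/
theorem subsingleton_coind (S : Subgroup G) (A : Rep.{u} k S) :
    Subsingleton (groupCohomology (Rep.coind S.subtype A) n) ↔
      Subsingleton (groupCohomology A n) :=
  (groupCohomology.coindIso A n).toLinearEquiv.toEquiv.subsingleton_congr

end Cochains

/-! ### Shapiro's lemma for Hom out of a permutation module. -/

section PermutationModules

variable {k G : Type u} [CommRing k] [Group G] {n : ℕ}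

/-- The `k[G]`-module `Hom_k(P, N)`, with `G` acting by conjugation. -/
abbrev homRep (P N : Rep.{u} k G) : Rep.{u} k G := Rep.of (Representation.linHom P.ρ N.ρ)

theorem homRep_ρ_apply (P N : Rep.{u} k G) (g : G) (φ : P →ₗ[k] N) (p : P) :
    ((homRep P N).ρ g φ : P →ₗ[k] N) p = N.ρ g (φ (P.ρ g⁻¹ p)) := rfl

theorem homRep_ρ_apply_ρ (P N : Rep.{u} k G) (g : G) (φ : P →ₗ[k] N) (p : P) :
    ((homRep P N).ρ g φ : P →ₗ[k] N) (P.ρ g p) = N.ρ g (φ p) := by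
  rw [homRep_ρ_apply, Representation.inv_self_apply]

variable {P N : Rep.{u} k G} {X : Type u} [MulAction G X]

/-- For an equivariant family `b : X → P`, evaluation at `b x` as a map from `Hom(P, N)` to the
module coinduced from the stabilizer of `x`. -/
def evalCoind (b : X → P) (hb : ∀ (g : G) (x : X), P.ρ g (b x) = b (g • x)) (x : X) :
    homRep P N →ₗ[k]
      Rep.coind (MulAction.stabilizer G x).subtype
        (Rep.res (MulAction.stabilizer G x).subtype N) where
  toFun φ := ⟨fun g => ((homRep P N).ρ g φ : P →ₗ[k] N) (b x), fun s g => by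
    change ((homRep P N).ρ (s * g) φ : P →ₗ[k] N) (b x) = _
    rw [map_mul]
    have h : P.ρ (s : G)⁻¹ (b x) = b x := by
      rw [hb, MulAction.mem_stabilizer_iff.1 (inv_mem s.2)]
    change N.ρ s (((homRep P N).ρ g φ : P →ₗ[k] N) (P.ρ (s : G)⁻¹ (b x))) = _
    rw [h]
    rfl⟩
  map_add' φ ψ := by
    apply Subtype.ext
    funext g
    change ((homRep P N).ρ g (φ + ψ) : P →ₗ[k] N) (b x) = _
    rw [map_add]
    rfl
  map_smul' r φ := by
    apply Subtype.ext
    funext g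
    change ((homRep P N).ρ g (r • φ) : P →ₗ[k] N) (b x) = _
    rw [map_smul]
    rfl

theorem evalCoind_ρ (b : X → P) (hb : ∀ (g : G) (x : X), P.ρ g (b x) = b (g • x)) (x : X)
    (g : G) (φ : homRep P N) :
    evalCoind b hb x ((homRep P N).ρ g φ) =
      (Rep.coind (MulAction.stabilizer G x).subtype
        (Rep.res (MulAction.stabilizer G x).subtype N)).ρ g (evalCoind b hb x φ) := by
  apply Subtype.ext
  funext h
  change ((homRep P N).ρ h ((homRep P N).ρ g φ) : P →ₗ[k] N) (b x) =
    ((homRep P N).ρ (h * g) φ : P →ₗ[k] N) (b x)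
  rw [map_mul]
  rfl

/-- Let `P` be a module with a permuted basis `b : X → P`. Then `Hⁿ⁺¹(G, Hom(P, N))` vanishes if
the cohomology of all the stabilizers in that degree, with coefficients in `N`, does. -/
theorem subsingleton_homRep_of_stabilizer (b : X → P)
    (hb : ∀ (g : G) (x : X), P.ρ g (b x) = b (g • x))
    (hex : ∀ ψ : X → N, ∃ φ : P →ₗ[k] N, ∀ x, φ (b x) = ψ x)
    (hext : ∀ φ : P →ₗ[k] N, (∀ x, φ (b x) = 0) → φ = 0)
    (hN : ∀ x : X, Subsingleton (groupCohomology
      (Rep.res (MulAction.stabilizer G x).subtype N) (n + 1))) :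
    Subsingleton (groupCohomology (homRep P N) (n + 1)) := by
  refine subsingleton_of_exists_d_eq fun f hf => ?_
  have hsol : ∀ x : X, ∃ h : (Fin n → G) → Rep.coind (MulAction.stabilizer G x).subtype
        (Rep.res (MulAction.stabilizer G x).subtype N),
      inhomogeneousCochains.d _ n h = fun y => evalCoind b hb x (f y) := fun x => by
    have := (subsingleton_coind _ _).2 (hN x)
    refine exists_d_eq_of_subsingleton _ ?_
    rw [d_comp_linearMap _ (evalCoind_ρ b hb x), hf]
    funext y
    exact map_zero _
  choose h hh using hsol
  -- Choose orbit representatives r y and elements γ y carrying r y to y.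
  have horb : ∀ y : X, ∃ γ : G,
      γ • (Quotient.out (Quotient.mk (MulAction.orbitRel G X) y)) = y := fun y =>
    MulAction.orbitRel_apply.1 ((MulAction.orbitRel G X).symm
      (Quotient.mk_out (s := MulAction.orbitRel G X) y))
  choose γ hγ using horb
  set r : X → X := fun y => Quotient.out (Quotient.mk (MulAction.orbitRel G X) y) with hr
  have hrg : ∀ (g : G) (y : X), r (g • y) = r y := fun g y => by
    simp only [hr]
    congr 1
    exact Quotient.sound ⟨g, rfl⟩
  have hrr : ∀ y, r (r y) = r y := fun y => by
    conv_rhs => rw [← hγ y]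
    rw [hrg]
  -- The coinduced function of φ at r x takes the value (γ x)⁻¹ φ(b x) at (γ x)⁻¹. Solving for φ(b
  -- x) dictates this formula.
  choose F hF using fun y : Fin n → G => hex fun x => N.ρ (γ x) ((h (r x) y).1 (γ x)⁻¹)
  have hFh : ∀ (x : X) (y : Fin n → G), evalCoind b hb (r x) (F y) = h (r x) y := by
    intro x y
    apply Subtype.ext
    funext g
    change N.ρ g (F y (P.ρ g⁻¹ (b (r x)))) = _
    rw [hb, hF]
    set z := g⁻¹ • r x with hz
    have hrz : r z = r x := by rw [hz, hrg, hrr]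
    -- The formula for F uses only the value at (γ z)⁻¹. Since g · γ z fixes the representative,
    -- equivariance of the coinduced function carries this value to the one at g.
    have hs : g * γ z ∈ MulAction.stabilizer G (r x) := by
      rw [MulAction.mem_stabilizer_iff, mul_smul]
      have := hγ z
      change γ z • r z = z at this
      rw [hrz] at this
      rw [this, hz, smul_inv_smul]
    rw [hrz]
    have := (h (r x) y).2 ⟨g * γ z, hs⟩ (γ z)⁻¹
    change (h (r x) y).1 (g * γ z * (γ z)⁻¹) = N.ρ (g * γ z) _ at this
    rw [mul_inv_cancel_right] at this
    rw [this, map_mul]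
    rfl
  refine ⟨F, funext fun y => sub_eq_zero.1 (hext _ fun x => ?_)⟩
  set δ : P →ₗ[k] N := inhomogeneousCochains.d (homRep P N) n F y - f y with hδ
  have hzero : evalCoind b hb (r x) δ = 0 := by
    rw [hδ, map_sub, sub_eq_zero]
    have h1 := congrFun (d_comp_linearMap _ (evalCoind_ρ b hb (r x)) F) y
    simp only [hFh] at h1
    exact h1.symm.trans (congrFun (hh (r x)) y)
  have h2 := congrFun (congrArg Subtype.val hzero) (γ x)⁻¹
  change N.ρ (γ x)⁻¹ (δ (P.ρ (γ x)⁻¹⁻¹ (b (r x)))) = 0 at h2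
  rw [inv_inv, hb] at h2
  have h3 := congrArg (N.ρ (γ x)) h2
  rw [Representation.self_inv_apply, map_zero] at h3
  have := hγ x
  change γ x • r x = x at this
  rwa [this] at h3

end PermutationModules

/-! ### Coboundaries with flexible degree indices. -/

section Coboundaries

variable {k G : Type u} [CommRing k] [Group G] {A : Rep.{u} k G} {n : ℕ}

/-- The predicate that an inhomogeneous cochain of positive degree is a coboundary. -/
def IsCoboundary (f : (Fin n → G) → A) : Prop :=
  ∃ m, ∃ hm : m + 1 = n, ∃ h : (Fin m → G) → A,
    ∀ x, f x = inhomogeneousCochains.d A m h (fun i => x (Fin.cast hm i))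

theorem IsCoboundary.comp_cast {f : (Fin n → G) → A} (hf : IsCoboundary f) {m : ℕ} (e : n = m) :
    IsCoboundary fun x : Fin m → G => f fun i => x (Fin.cast e i) := by
  subst e
  exact hf

theorem IsCoboundary.add_d {f : (Fin (n + 1) → G) → A} (hf : IsCoboundary f)
    (h : (Fin n → G) → A) :
    IsCoboundary fun x => inhomogeneousCochains.d A n h x + f x := by
  obtain ⟨m, hm, h', H⟩ := hf
  obtain rfl : m = n := by omega
  refine ⟨m, rfl, h + h', fun x => ?_⟩
  rw [map_add]
  exact congrArg (_ + ·) (H x)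

end Coboundaries

/-! ### Cup products followed by a pairing or an evaluation. -/

section Contraction

variable {k G : Type u} [CommRing k] [Group G] {p r : ℕ}

theorem d_comp_hom {A B : Rep.{u} k G} {n : ℕ} (φ : A ⟶ B) (f : (Fin n → G) → A) :
    inhomogeneousCochains.d B n (fun y => φ.hom (f y)) =
      fun x => φ.hom (inhomogeneousCochains.d A n f x) :=
  d_comp_linearMap φ.hom.toLinearMap (fun g a => Rep.hom_comm_apply φ g a) f

/-- The evaluation `J ⊗ Hom(J, N) ⟶ N`. -/
def evalHom (J N : Rep.{u} k G) : J ⊗ homRep J N ⟶ N :=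
  Rep.ofHom ⟨TensorProduct.lift (LinearMap.applyₗ (R := k) (M := J) (M₂ := N)), fun g => by
    refine TensorProduct.ext' fun a φ => ?_
    exact homRep_ρ_apply_ρ J N g φ a⟩

/-- The contraction `(X ⊗ J) ⊗ Hom(J, N) ⟶ X ⊗ N ⟶ A`. -/
def contract {X N A : Rep.{u} k G} (J : Rep.{u} k G) (f : X ⊗ N ⟶ A) :
    (X ⊗ J) ⊗ homRep J N ⟶ A :=
  (α_ X J (homRep J N)).hom ≫ (X ◁ evalHom J N) ≫ f

theorem contract_tmul {X N A J : Rep.{u} k G} (f : X ⊗ N ⟶ A) (a : X) (b : J)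
    (φ : J →ₗ[k] N) :
    (contract J f).hom ((a ⊗ₜ[k] b) ⊗ₜ[k] φ) = f.hom (a ⊗ₜ[k] φ b) := rfl

variable {X N A : Rep.{u} k G} (f : X ⊗ N ⟶ A)

/-- The cup product of cochains followed by a pairing. -/
def pairCochain (v : (Fin p → G) → X) (y : (Fin r → G) → N) : (Fin (p + r) → G) → A :=
  fun x => f.hom (cupCochain v y x)

theorem pairCochain_zero_right (v : (Fin p → G) → X) (x : Fin (p + r) → G) :
    pairCochain f v (0 : (Fin r → G) → N) x = 0 :=
  (congrArg _ (cupCochain_zero_right v x)).trans (map_zero f.hom)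

theorem pairCochain_zero_left (y : (Fin r → G) → N) (x : Fin (p + r) → G) :
    pairCochain f (0 : (Fin p → G) → X) y x = 0 :=
  (congrArg _ (cupCochain_zero_left y x)).trans (map_zero f.hom)

theorem pairCochain_add_right (v : (Fin p → G) → X) (y y' : (Fin r → G) → N)
    (x : Fin (p + r) → G) :
    pairCochain f v (fun z => y z + y' z) x = pairCochain f v y x + pairCochain f v y' x := by
  unfold pairCochain
  rw [← map_add]
  congr 1
  unfold cupCochain
  rw [map_add]
  exact TensorProduct.tmul_add _ _ _

theorem d_pairCochain (v : (Fin p → G) → X) (y : (Fin r → G) → N) (x : Fin (p + r + 1) → G) :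
    inhomogeneousCochains.d A (p + r) (pairCochain f v y) x =
      pairCochain f (inhomogeneousCochains.d _ p v) y (fun i => x (Fin.cast (by omega) i)) +
        (-1 : k) ^ p • pairCochain (r := r + 1) f v (inhomogeneousCochains.d _ r y) x := by
  refine (congrFun (d_comp_hom f (cupCochain v y)) x).trans ?_
  rw [cupCochain_d, map_add, map_smul]
  rfl

theorem pairCochain_d (v : (Fin p → G) → X) (hv : inhomogeneousCochains.d _ p v = 0)
    (y : (Fin r → G) → N) (x : Fin (p + r + 1) → G) :
    pairCochain (r := r + 1) f v (inhomogeneousCochains.d _ r y) x =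
      inhomogeneousCochains.d A (p + r) ((-1 : k) ^ p • pairCochain f v y) x := by
  rw [map_smul]
  change _ = (-1 : k) ^ p • inhomogeneousCochains.d A (p + r) (pairCochain f v y) x
  rw [d_pairCochain, hv, pairCochain_zero_left, zero_add, smul_smul, ← mul_pow]
  simp

/-- By the Leibniz rule, if v = dh and dy = 0 then v ∪ y = d(h ∪ y). -/
theorem isCoboundary_pairCochain {v : (Fin p → G) → X} (hv : IsCoboundary v)
    (y : (Fin r → G) → N) (hy : inhomogeneousCochains.d _ r y = 0) :
    IsCoboundary (pairCochain f v y) := by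
  obtain ⟨m, rfl, h, H⟩ := hv
  refine ⟨m + r, by omega, pairCochain f h y, fun x => ?_⟩
  rw [d_pairCochain, hy, pairCochain_zero_right, smul_zero, add_zero, funext H]
  rfl

theorem partialProd_castAdd_one (x : Fin (p + 1) → G) :
    Fin.partialProd x (Fin.last (p + 1)) =
      Fin.partialProd (fun i => x (Fin.castAdd 1 i)) (Fin.last p) * x (Fin.natAdd p 0) := by
  rw [← Fin.succ_last, Fin.partialProd_succ, ← Fin.partialProd_init]
  rfl

/-- Associativity of cup products, followed by evaluation. -/
theorem pairCochain_contract {J : Rep.{u} k G} (v : (Fin p → G) → X) (c : (Fin 1 → G) → J)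
    (y : (Fin r → G) → homRep J N) (x : Fin (p + (r + 1)) → G) :
    pairCochain (r := r + 1) f v
        (fun z => ((homRep J N).ρ (z 0) (y fun i => z i.succ) : J →ₗ[k] N) (c fun _ => z 0)) x =
      pairCochain (contract J f) (cupCochain v c) y (fun i => x (Fin.cast (by omega) i)) := by
  have h1 : ∀ (g h : G) (φ : J →ₗ[k] N) (j : J),
      N.ρ g (((homRep J N).ρ h φ : J →ₗ[k] N) j) =
        ((homRep J N).ρ (g * h) φ : J →ₗ[k] N) (J.ρ g j) := fun g h φ j => by
    rw [map_mul]
    exact (homRep_ρ_apply_ρ J N g ((homRep J N).ρ h φ) j).symm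
  unfold pairCochain cupCochain
  refine Eq.trans ?_ (contract_tmul f _ _ _).symm
  rw [h1, partialProd_castAdd_one]
  congr 5
  · funext i
    exact congrArg x (Fin.ext (by simp; omega))
  · funext j
    exact congrArg x (Fin.ext (by simp))

end Contraction

/-! ### Dimension shifting along an augmented module, and its iteration. -/

/-- An augmented module `ε : P ⟶ k` with a chosen element `e` of augmentation `1`, together with a
module `J` over its augmentation ideal and a crossed homomorphism `c` to `J` over `g ↦ g e - e`. -/
structure AugmentedModule (k G : Type u) [CommRing k] [Group G] where
  /-- The augmented module. -/
  P : Rep.{u} k G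
  /-- The module mapping to the augmentation ideal. -/
  J : Rep.{u} k G
  /-- The map to the augmentation ideal. -/
  ι : J ⟶ P
  /-- The augmentation. -/
  ε : P →ₗ[k] k
  ε_ρ : ∀ g p, ε (P.ρ g p) = ε p
  ε_ι : ∀ j, ε (ι.hom j) = 0
  /-- An element of augmentation `1`. -/
  e : P
  ε_e : ε e = 1
  /-- The crossed homomorphism. -/
  c : (Fin 1 → G) → J
  ι_c : ∀ x, ι.hom (c x) = P.ρ (x 0) e - e

namespace AugmentedModule

variable {k G : Type u} [CommRing k] [Group G] (D : AugmentedModule k G) {N : Rep.{u} k G} {r : ℕ}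

/-- If `H^{r+1}(G, Hom(P, N)) = 0` then, up to coboundaries, every `(r + 1)`-cocycle with values
in `N` is the product of `c` with an `r`-cocycle with values in `Hom(J, N)`. -/
theorem exists_eq_d_add (hN : Subsingleton (groupCohomology (homRep D.P N) (r + 1)))
    (x : (Fin (r + 1) → G) → N) (hx : inhomogeneousCochains.d N (r + 1) x = 0) :
    ∃ (y : (Fin r → G) → homRep D.J N) (h : (Fin r → G) → N),
      inhomogeneousCochains.d _ r y = 0 ∧ ∀ z, x z = inhomogeneousCochains.d N r h z +
        ((homRep D.J N).ρ (z 0) (y fun i => z i.succ) : D.J →ₗ[k] N) (D.c fun _ => z 0) := by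
  let η : N →ₗ[k] homRep D.P N := LinearMap.mk₂ k
    (fun (n : N) (p : D.P) => D.ε p • n) (fun _ _ _ => smul_add _ _ _)
    (fun _ _ _ => smul_comm _ _ _) (fun _ _ _ => by rw [map_add, add_smul])
    (fun _ _ _ => by rw [map_smul, smul_assoc])
  -- The map η is n ↦ ε(·) n, dual to the augmentation; `res` below is dual to J → P, and their
  -- composite is zero.
  have hηρ : ∀ g n, η (N.ρ g n) = (homRep D.P N).ρ g (η n) := fun g n => by
    refine LinearMap.ext fun p => ?_
    change D.ε p • N.ρ g n = N.ρ g (D.ε (D.P.ρ g⁻¹ p) • n)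
    rw [D.ε_ρ, map_smul]
  let res : homRep D.P N →ₗ[k] homRep D.J N := LinearMap.lcomp k N D.ι.hom.toLinearMap
  have hres : ∀ g φ, res ((homRep D.P N).ρ g φ) = (homRep D.J N).ρ g (res φ) := fun g φ => by
    refine LinearMap.ext fun j => ?_
    exact congrArg (fun q => N.ρ g (φ q)) (Rep.hom_comm_apply D.ι g⁻¹ j).symm
  obtain ⟨F, hF⟩ := exists_d_eq_of_subsingleton (A := homRep D.P N) (fun z => η (x z)) (by
    rw [d_comp_linearMap η hηρ, hx]
    funext z
    exact map_zero η)
  have hres0 : ∀ n, res (η n) = 0 := fun n => LinearMap.ext fun j => by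
    change D.ε (D.ι.hom j) • n = 0
    rw [D.ε_ι, zero_smul]
  let ev : homRep D.P N →ₗ[k] N := LinearMap.applyₗ (R := k) (M := D.P) D.e
  -- With dF = η x, restriction to J gives a cocycle, and evaluation at e recovers x from η x. Since
  -- e need not be invariant, evaluation fails to commute with d: the defect is (z₀F)(e) -
  -- (z₀F)(z₀e) = -(z₀F)(ι c(z₀)), whence the minus sign in y = -res F.
  refine ⟨fun z => -res (F z), fun z => ev (F z), ?_, fun z => ?_⟩
  · have h := d_comp_linearMap (-res) (fun g φ => by
      rw [LinearMap.neg_apply, LinearMap.neg_apply, hres, map_neg]) F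
    refine h.trans (funext fun z => ?_)
    rw [hF, LinearMap.neg_apply, hres0]
    exact neg_zero
  · have h1 : x z = ev (inhomogeneousCochains.d (homRep D.P N) r F z) := by
      rw [hF]
      change x z = D.ε D.e • x z
      rw [D.ε_e, one_smul]
    rw [h1, inhomogeneousCochains.d_hom_apply, inhomogeneousCochains.d_hom_apply, map_add, map_sum]
    simp only [map_smul]
    rw [add_right_comm]
    congr 1
    have h2 : N.ρ (z 0) (ev (F fun i => z i.succ)) =
        ((homRep D.P N).ρ (z 0) (F fun i => z i.succ) : D.P →ₗ[k] N) (D.P.ρ (z 0) D.e) :=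
      (homRep_ρ_apply_ρ D.P N (z 0) (F fun i => z i.succ) D.e).symm
    rw [h2, map_neg, ← hres]
    change ((homRep D.P N).ρ (z 0) (F fun i => z i.succ) : D.P →ₗ[k] N) D.e = _ +
      -((homRep D.P N).ρ (z 0) (F fun i => z i.succ) : D.P →ₗ[k] N) (D.ι.hom (D.c fun _ => z 0))
    rw [D.ι_c, map_sub]
    abel

end AugmentedModule

/-- An augmented module with the tensor powers of `J` and the cup powers of `c`. -/
structure AugmentedTower (k G : Type u) [CommRing k] [Group G] extends AugmentedModule k G where
  /-- The tensor powers of `J`. -/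
  T : ℕ → Rep.{u} k G
  /-- The cup powers of `c`. -/
  V : ∀ s, (Fin s → G) → T s
  d_V : ∀ s, inhomogeneousCochains.d (T s) s (V s) = 0
  /-- The zeroth power is the unit. -/
  unit : T 0 ⟶ 𝟙_ (Rep.{u} k G)
  unit_V : ∀ x, unit.hom (V 0 x) = (1 : k)
  /-- The powers are obtained inductively by tensoring with `J`. -/
  μ : ∀ s, T (s + 1) ⟶ T s ⊗ J
  μ_V : ∀ s x, (μ s).hom (V (s + 1) x) = cupCochain (V s) c x

namespace AugmentedTower

variable {k G : Type u} [CommRing k] [Group G] (D : AugmentedTower k G) {N A : Rep.{u} k G}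
  {r n : ℕ}

theorem pairCochain_μ (s : ℕ) (g : (D.T s ⊗ D.J) ⊗ N ⟶ A) (y : (Fin r → G) → N)
    (x : Fin (s + 1 + r) → G) :
    pairCochain ((D.μ s ▷ N) ≫ g) (D.V (s + 1)) y x =
      pairCochain g (cupCochain (D.V s) D.c) y x := by
  have h : cupCochain (D.V s) D.c = fun z => (D.μ s).hom (D.V (s + 1) z) :=
    funext fun z => (D.μ_V s z).symm
  rw [h]
  rfl

/-- Each step trades a factor of y for one more factor c: y = dh + c ∪ y' turns cˢ ∪ y into a
coboundary plus cˢ⁺¹ ∪ y', with N replaced by Hom(J, N). The induction is on j = m - s and ends at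
the power assumed to be a coboundary. The vanishing for the current N is a separate hypothesis
because the initial N need not be of the form Hom(J, -). -/
theorem isCoboundary_pairCochain_V {m : ℕ} (hm : m ≤ n) (hpow : IsCoboundary (D.V m))
    (hJ : ∀ s, 0 < s → s < m → ∀ N : Rep.{u} k G,
      Subsingleton (groupCohomology (homRep D.P (homRep D.J N)) (n - s))) (j : ℕ) :
    ∀ (s r : ℕ) (N : Rep.{u} k G), s + j = m → s + r = n →
      (0 < j → Subsingleton (groupCohomology (homRep D.P N) r)) →
      ∀ (f : D.T s ⊗ N ⟶ A) (y : (Fin r → G) → N),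
      inhomogeneousCochains.d _ r y = 0 → IsCoboundary (pairCochain f (D.V s) y) := by
  induction j with
  | zero =>
    rintro s r N rfl - - f y hy
    exact isCoboundary_pairCochain f hpow y hy
  | succ j ih =>
    intro s r N hs hr hN f y hy
    obtain ⟨r, rfl⟩ : ∃ r', r = r' + 1 := ⟨r - 1, by omega⟩
    obtain ⟨y', h, hy', H⟩ := D.exists_eq_d_add (hN (by omega)) y hy
    have h1 := ih (s + 1) r (homRep D.J N) (by omega) (by omega)
      (fun hj => by simpa [show n - (s + 1) = r by omega] using hJ (s + 1) (by omega) (by omega) N)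
      ((D.μ s ▷ _) ≫ contract D.J f) y' hy'
    -- As cˢ is a cocycle, cˢ ∪ dh = d((-1)ˢ cˢ ∪ h).
    have h2 := (h1.comp_cast (show s + 1 + r = s + r + 1 by omega)).add_d
      ((-1 : k) ^ s • pairCochain f (D.V s) h)
    refine (congrArg IsCoboundary (funext fun x => ?_)).mpr h2
    rw [funext H, pairCochain_add_right, pairCochain_contract, ← pairCochain_μ]
    exact congrArg (· + _) (pairCochain_d f (D.V s) (D.d_V s) h x)

/-- If the `m`-th power of `c` is a coboundary and the modules `Hom(P, A)` and
`Hom(P, Hom(J, N))` have no cohomology in the relevant degrees, then `Hⁿ(G, A) = 0`. -/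
theorem subsingleton_of_isCoboundary_V {m : ℕ} (hn : 0 < n) (hm : m ≤ n)
    (hpow : IsCoboundary (D.V m))
    (hA : Subsingleton (groupCohomology (homRep D.P A) n))
    (hJ : ∀ s, 0 < s → s < m → ∀ N : Rep.{u} k G,
      Subsingleton (groupCohomology (homRep D.P (homRep D.J N)) (n - s))) :
    Subsingleton (groupCohomology A n) := by
  obtain ⟨n, rfl⟩ : ∃ n', n = n' + 1 := ⟨n - 1, by omega⟩
  refine subsingleton_of_exists_d_eq fun y hy => ?_
  -- Start from s = 0: the zeroth power is the unit, so its product with y is y itself.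
  obtain ⟨l, hl, h, H⟩ := (D.isCoboundary_pairCochain_V hm hpow hJ m 0 (n + 1) A (by omega)
    (by omega) (fun _ => hA) ((D.unit ▷ A) ≫ (λ_ A).hom) y hy).comp_cast
      (show 0 + (n + 1) = n + 1 by omega)
  obtain rfl : l = n := by omega
  refine ⟨h, funext fun x => (H x).symm.trans ?_⟩
  have hV : ∀ z a, ((D.unit ▷ A) ≫ (λ_ A).hom).hom (D.V 0 z ⊗ₜ[k] a) = a := fun z a => by
    change D.unit.hom (D.V 0 z) • a = a
    rw [D.unit_V, one_smul]
  refine (hV _ _).trans ?_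
  rw [show Fin.last 0 = 0 from rfl, Fin.partialProd_zero, map_one]
  exact congrArg y (funext fun i => congrArg x (Fin.ext (by simp)))

end AugmentedTower

/-! ### The regular representation. -/

section Regular

variable {k G : Type u} [CommRing k] [Group G]

/-- The modules `Hom(k[G], N)` are acyclic. -/
theorem subsingleton_homRep_leftRegular (N : Rep.{u} k G) (n : ℕ) :
    Subsingleton (groupCohomology (homRep (Rep.leftRegular k G) N) (n + 1)) := by
  refine subsingleton_homRep_of_stabilizer (X := G)
    (fun g => (MonoidAlgebra.single g 1 : MonoidAlgebra k G))
    (fun g x => Representation.ofMulAction_single g x 1)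
    (fun ψ => ⟨(MonoidAlgebra.basis G k).constr k ψ, fun x => ?_⟩)
    (fun φ hφ => (MonoidAlgebra.basis G k).ext fun x => ?_) fun x => ?_
  · rw [← MonoidAlgebra.basis_apply, Module.Basis.constr_basis]
  · rw [MonoidAlgebra.basis_apply, hφ, LinearMap.zero_apply]
  · have : Subsingleton (MulAction.stabilizer G x) := by
      refine ⟨fun a b => Subtype.ext ?_⟩
      have ha := MulAction.mem_stabilizer_iff.1 a.2
      have hb := MulAction.mem_stabilizer_iff.1 b.2
      exact mul_right_cancel (ha.trans hb.symm)
    exact ModuleCat.subsingleton_of_isZero (isZero_groupCohomology_succ_of_subsingleton _ n)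

/-- The augmentation `k[G] → k`. -/
def regularAugmentation (k G : Type u) [CommRing k] [Group G] : Rep.leftRegular k G →ₗ[k] k :=
  (MonoidAlgebra.basis G k).constr k fun _ => (1 : k)

theorem regularAugmentation_single (g : G) :
    regularAugmentation k G (MonoidAlgebra.single g 1) = 1 := by
  rw [← MonoidAlgebra.basis_apply]
  exact Module.Basis.constr_basis _ _ _ _

theorem regularAugmentation_ρ (g : G) (p : Rep.leftRegular k G) :
    regularAugmentation k G ((Rep.leftRegular k G).ρ g p) = regularAugmentation k G p := by
  have h : regularAugmentation k G ∘ₗ (Rep.leftRegular k G).ρ g = regularAugmentation k G :=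
    (MonoidAlgebra.basis G k).ext fun x => by
      rw [MonoidAlgebra.basis_apply, regularAugmentation_single]
      refine (congrArg (regularAugmentation k G)
        (Representation.ofMulAction_single g x (1 : k))).trans ?_
      exact regularAugmentation_single _
  exact LinearMap.congr_fun h p

end Regular

/-! ### Crossed homomorphisms as 1-cocycles. -/

section CrossedHom

variable {k G : Type u} [CommRing k] [Group G]

theorem d_crossedHom {M : Rep.{u} k G} (c : G → M)
    (hc : ∀ a b, c (a * b) = c a + M.ρ a (c b)) :
    inhomogeneousCochains.d M 1 (fun x => c (x 0)) = 0 := by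
  funext x
  rw [inhomogeneousCochains.d_hom_apply, Fin.sum_univ_two]
  have h0 : Fin.contractNth (0 : Fin 2) (· * ·) x 0 = x 0 * x 1 := rfl
  have h1 : Fin.contractNth (1 : Fin 2) (· * ·) x 0 = x 0 := rfl
  simp only [h0, h1, hc, Fin.val_zero, Fin.val_one, zero_add, pow_one, one_add_one_eq_two,
    neg_one_sq, neg_smul, one_smul]
  change M.ρ (x 0) (c (x 1)) + (-(c (x 0) + M.ρ (x 0) (c (x 1))) + c (x 0)) = 0
  abel

/-- Identifies the correction term in `AugmentedModule.exists_eq_d_add` as an evaluated cup product,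
so that the Leibniz rule applies to it. -/
theorem pairCochain_evalHom {J N : Rep.{u} k G} {r : ℕ} (c : (Fin 1 → G) → J)
    (y : (Fin r → G) → homRep J N) (z : Fin (r + 1) → G) :
    pairCochain (evalHom J N) c y (fun i => z (Fin.cast (by omega) i)) =
      ((homRep J N).ρ (z 0) (y fun i => z i.succ) : J →ₗ[k] N) (c fun _ => z 0) := by
  have h0 : Fin.partialProd (fun i : Fin 1 => z (Fin.cast (by omega) (Fin.castAdd r i)))
      (Fin.last 1) = z 0 := by
    rw [← Fin.succ_last, Fin.partialProd_succ]
    simp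
    exact congrArg z (Fin.ext rfl)
  have h1 : (fun j : Fin r => z (Fin.cast (by omega) (Fin.natAdd 1 j))) = fun i => z i.succ :=
    funext fun j => congrArg z (Fin.ext (Nat.add_comm _ _))
  have h2 : (fun i : Fin 1 => z (Fin.cast (by omega) (Fin.castAdd r i))) = fun _ => z 0 :=
    funext fun j => congrArg z (Fin.ext (by simp))
  unfold pairCochain cupCochain
  rw [h0, h1, h2]
  rfl

end CrossedHom

/-! ### Cohomology of the infinite cyclic group. -/

section InfiniteCyclic

variable {k : Type} [CommRing k]

theorem crossedHom_eq_zero {M : Rep.{0} k (Multiplicative ℤ)} (c : Multiplicative ℤ → M)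
    (hc : ∀ a b, c (a * b) = c a + M.ρ a (c b)) (h : c (Multiplicative.ofAdd 1) = 0)
    (a : Multiplicative ℤ) :
    c a = 0 := by
  have hs : ∀ n : ℤ, c (Multiplicative.ofAdd (n + 1)) = c (Multiplicative.ofAdd n) := fun n => by
    rw [ofAdd_add, hc, h, map_zero, add_zero]
  have h0 : c 1 = 0 := by
    have := hc 1 1
    rw [mul_one, map_one] at this
    exact left_eq_add.1 this
  suffices ∀ n : ℤ, c (Multiplicative.ofAdd n) = 0 from this (Multiplicative.toAdd a)
  intro n
  induction n using Int.induction_on with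
  | zero => exact h0
  | succ n ih => rw [hs, ih]
  | pred n ih => rw [← hs, sub_add_cancel, ih]

/-- A crossed homomorphism on the infinite cyclic group has an arbitrary value at the generator. -/
theorem exists_crossedHom (M : Rep.{0} k (Multiplicative ℤ)) (m : M) :
    ∃ c : Multiplicative ℤ → M, c (Multiplicative.ofAdd 1) = m ∧
      ∀ a b, c (a * b) = c a + M.ρ a (c b) := by
  let t : (Multiplicative ℤ) := Multiplicative.ofAdd 1
  -- Crossed homomorphisms correspond to affine actions: with t acting by x ↦ tx + m, the orbit map
  -- n ↦ φⁿ(0) is the one sought.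
  let φ : Equiv.Perm M :=
    { toFun := fun x => M.ρ t x + m
      invFun := fun x => M.ρ t⁻¹ (x - m)
      left_inv := fun x => by simp
      right_inv := fun x => by simp }
  have hφ : ∀ x, φ x = M.ρ t x + m := fun _ => rfl
  have hφ' : ∀ x, φ⁻¹ x = M.ρ t⁻¹ (x - m) := fun _ => rfl
  have key : ∀ (n : ℤ) (x : M), (φ ^ n) x = M.ρ (Multiplicative.ofAdd n) x + (φ ^ n) 0 := by
    intro n
    induction n using Int.induction_on with
    | zero => intro x; simp
    | succ n ih =>
      intro x
      rw [add_comm, zpow_add, zpow_one, Equiv.Perm.mul_apply, ih x, Equiv.Perm.mul_apply, hφ, hφ,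
        map_add, ofAdd_add, map_mul, Module.End.mul_apply, add_assoc]
    | pred n ih =>
      intro x
      rw [sub_eq_add_neg, add_comm, zpow_add, zpow_neg_one, Equiv.Perm.mul_apply, ih x,
        Equiv.Perm.mul_apply, hφ', hφ', ofAdd_add, map_mul, Module.End.mul_apply, add_sub_assoc,
        map_add]
      rfl
  refine ⟨fun a => (φ ^ Multiplicative.toAdd a) 0, ?_, fun a b => ?_⟩
  · simp [hφ]
  · simp only [toAdd_mul]
    rw [zpow_add, Equiv.Perm.mul_apply, key, add_comm]
    rfl

/-- The resolution `0 → k[C] → k[C] → k → 0` over the infinite cyclic group. -/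
theorem exists_augmentedModule_infiniteCyclic : ∃ D : AugmentedModule k (Multiplicative ℤ),
    D.P = Rep.leftRegular k (Multiplicative ℤ) ∧ D.J = Rep.leftRegular k (Multiplicative ℤ) ∧
      inhomogeneousCochains.d D.J 1 D.c = 0 := by
  let P := Rep.leftRegular k (Multiplicative ℤ)
  let e : P := (MonoidAlgebra.single 1 1 : MonoidAlgebra k (Multiplicative ℤ))
  -- The map ι sends the basis element 1 to te - e. Choosing c(t) = e makes ι ∘ c and g ↦ ge - e
  -- agree at the generator, hence everywhere.
  let q : P := P.ρ (Multiplicative.ofAdd 1) e - e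
  let ι : P ⟶ P := (Rep.leftRegularHomEquiv P).symm q
  have hι : ∀ g, ι.hom (MonoidAlgebra.single g 1 : MonoidAlgebra k (Multiplicative ℤ)) = P.ρ g q :=
    fun g => Rep.leftRegularHomEquiv_symm_single q g
  obtain ⟨c, hc1, hc⟩ := exists_crossedHom P e
  refine ⟨{
    P := P
    J := P
    ι := ι
    ε := regularAugmentation k (Multiplicative ℤ)
    ε_ρ := regularAugmentation_ρ
    ε_ι := fun j => ?_
    e := e
    ε_e := regularAugmentation_single 1
    c := fun x => c (x 0)
    ι_c := fun x => ?_ }, rfl, rfl, ?_⟩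
  · have h : regularAugmentation k (Multiplicative ℤ) ∘ₗ ι.hom.toLinearMap = 0 :=
      (MonoidAlgebra.basis (Multiplicative ℤ) k).ext fun g => by
        rw [MonoidAlgebra.basis_apply]
        refine (congrArg (regularAugmentation k (Multiplicative ℤ)) (hι g)).trans ?_
        rw [regularAugmentation_ρ, map_sub, regularAugmentation_ρ, sub_self]
        rfl
    exact LinearMap.congr_fun h j
  · refine sub_eq_zero.1 (crossedHom_eq_zero (M := P)
      (fun g => ι.hom (c g) - (P.ρ g e - e)) (fun a b => ?_) ?_ (x 0))
    · have := Rep.hom_comm_apply ι a (c b)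
      simp only [hc, map_add, map_sub, map_mul, Module.End.mul_apply]
      rw [this]
      abel
    · simp only [hc1]
      rw [hι, map_one]
      exact sub_self q
  · exact d_crossedHom c hc

/-- The infinite cyclic group has cohomological dimension at most `1`. -/
theorem subsingleton_of_infiniteCyclic (N : Rep.{0} k (Multiplicative ℤ)) (n : ℕ) :
    Subsingleton (groupCohomology N (n + 2)) := by
  obtain ⟨D, hP, hJ, hc⟩ := exists_augmentedModule_infiniteCyclic (k := k)
  refine subsingleton_of_exists_d_eq fun x hx => ?_
  have h1 : Subsingleton (groupCohomology (homRep D.P N) (n + 2)) := by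
    rw [hP]; exact subsingleton_homRep_leftRegular N (n + 1)
  have h2 : Subsingleton (groupCohomology (homRep D.J N) (n + 1)) := by
    rw [hJ]; exact subsingleton_homRep_leftRegular N n
  obtain ⟨y, h, hy, H⟩ := D.exists_eq_d_add h1 x hx
  -- J is free as well, so y = dw; since c is a cocycle, c ∪ dw is then a coboundary.
  obtain ⟨w, rfl⟩ := exists_d_eq_of_subsingleton y hy
  have h3 := (show IsCoboundary (n := 1 + (n + 1)) _ from ⟨1 + n, rfl, _, fun z =>
    pairCochain_d (evalHom D.J N) D.c hc w z⟩).comp_cast (show 1 + (n + 1) = n + 1 + 1 by omega)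
  obtain ⟨l, hl, h', H'⟩ := h3.add_d h
  obtain rfl : l = n + 1 := by omega
  refine ⟨h', funext fun z => (H' z).symm.trans ((congrArg (_ + ·) ?_).trans (H z).symm)⟩
  exact pairCochain_evalHom D.c _ z

end InfiniteCyclic

/-! ### Cohomology of finite cyclic groups. -/

section FiniteCyclic

variable {k G : Type u} [CommRing k] [CommGroup G] [Fintype G]

/-- In positive even degrees the cohomology is invariants modulo norms, here k / |G| k, and the
class of 1 survives. -/
theorem nontrivial_of_finiteCyclic [IsCyclic G] (hG : ¬ IsUnit (Fintype.card G : k)) (i : ℕ)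
    (hi : Even i) (hi0 : i ≠ 0) : Nontrivial (groupCohomology (Rep.trivial k G k) i) := by
  obtain ⟨g, hg⟩ := IsCyclic.exists_generator (α := G)
  have : NeZero i := ⟨hi0⟩
  let A := Rep.trivial k G k
  let x : LinearMap.ker (Rep.applyAsHom A g - 𝟙 A).hom.toLinearMap := ⟨(1 : k), by
    rw [LinearMap.mem_ker, Rep.sub_hom]
    exact sub_self (1 : k)⟩
  refine ⟨⟨Rep.FiniteCyclicGroup.groupCohomologyπEven A g hg i hi x, 0, fun h => hG ?_⟩⟩
  rw [Rep.FiniteCyclicGroup.groupCohomologyπEven_eq_zero_iff] at h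
  obtain ⟨a, ha⟩ := h
  have ha' : (∑ _g : G, (a : k)) = 1 := by
    refine Eq.trans ?_ ha
    change _ = A.ρ.norm a
    rw [Representation.norm, LinearMap.sum_apply]
    rfl
  rw [Finset.sum_const, Finset.card_univ, nsmul_eq_mul] at ha'
  exact IsUnit.of_mul_eq_one _ ha'

end FiniteCyclic

/-! ### Cocycles for the powers of 𝔳, and the canonical tower. -/

section Power

variable (π : Type) [Group π]

/-- The cocycle representing the power `𝔳ˢ` of the canonical class. -/
def powCochain : (s : ℕ) → (Fin s → π × π) → augIdealPow π s
  | 0 => fun _ => (1 : ℤ)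
  | s + 1 => cupCochain (A := augIdealPow π s) (powCochain s) (canonicalCochain π)

theorem d_powCochain : ∀ s, inhomogeneousCochains.d (augIdealPow π s) s (powCochain π s) = 0
  | 0 => by
    funext x
    rw [inhomogeneousCochains.d_hom_apply]
    change (1 : ℤ) + _ = 0
    rw [Fin.sum_univ_one]
    rfl
  | s + 1 => d_cupCochain_eq_zero (A := augIdealPow π s) _ _ (d_powCochain s) (d_canonicalCochain π)

theorem canonicalClassPow_eq : ∀ s, canonicalClassPow π s =
    groupCohomology.π (augIdealPow π s) s
      (groupCohomology.cocyclesMk (powCochain π s) (d_powCochain π s))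
  | 0 => rfl
  | s + 1 => by
    refine (congrArg (fun c => cup c (canonicalClass π)) (canonicalClassPow_eq s)).trans ?_
    refine (cup_π _ _).trans (congrArg _ (cochain_injective ?_))
    rw [cupCocycle, cochain_mk, cochain_mk, cochain_mk]
    exact (cochain_mk (powCochain π (s + 1)) (d_powCochain π (s + 1))).symm

theorem isCoboundary_powCochain_of_eq_zero {s : ℕ} (hs : canonicalClassPow π s = 0) :
    IsCoboundary (powCochain π s) := by
  rw [canonicalClassPow_eq, π_eq_zero_iff, cochain_mk] at hs
  rcases hs with h | h
  · have h' : powCochain π s = 0 := by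
      rw [← cochain_mk _ (d_powCochain π s), h]
      exact map_zero (groupCohomology.iCocycles _ s).hom
    cases s with
    | zero =>
      -- In degree 0 there are no coboundaries, but 𝔳⁰ is the nonzero cocycle 1.
      exact absurd (congrFun h' Fin.elim0) (one_ne_zero (α := ℤ))
    | succ s =>
      refine ⟨s, rfl, 0, fun x => ?_⟩
      rw [map_zero, h']
      rfl
  · exact h

variable {π} {G : Type} [Group G]

/-- The augmented module `ℤ[π]`, the ideal `I` and the powers of the canonical class, pulled back
along a homomorphism to `π × π`. -/
def canonicalTower (θ : G →* π × π) : AugmentedTower ℤ G where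
  P := Rep.res θ (groupRing π)
  J := Rep.res θ (augIdeal π)
  ι := Rep.resMap θ (Rep.subtype (groupRing π) _ _)
  ε := augmentation π
  ε_ρ g p := augmentation_ρ π (θ g) p
  ε_ι j := j.2
  e := (MonoidAlgebra.single 1 1 : MonoidAlgebra ℤ π)
  ε_e := by simp [augmentation]
  c x := canonicalCochain π fun i => θ (x i)
  ι_c x := by
    refine Eq.trans ?_ (congrArg (· - _) (groupRing_single π (θ (x 0)) 1 1).symm)
    rw [mul_one]
    rfl
  T s := Rep.res θ (augIdealPow π s)
  V s x := powCochain π s fun i => θ (x i)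
  d_V s := by
    rw [d_res, d_powCochain]
    rfl
  -- Restriction along θ preserves the unit and tensor products definitionally, so both structure
  -- maps are identities.
  unit := 𝟙 (𝟙_ (Rep.{0} ℤ G))
  unit_V _ := rfl
  μ s := 𝟙 (MonoidalCategory.tensorObj (Rep.res θ (augIdealPow π s)) (Rep.res θ (augIdeal π)))
  μ_V s x := (cupCochain_res θ (powCochain π s) (canonicalCochain π) x).symm

end Power

/-! ### Vanishing for Hom out of k[X] and out of its augmentation ideal. -/

section PermutationVanishing

variable {k G K : Type u} [CommRing k] [Group G] [Group K] {X : Type u} [MulAction K X] {n : ℕ}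

theorem subsingleton_of_mulEquiv_of_forall (e : G ≃* K)
    (h : ∀ B : Rep.{u} k K, Subsingleton (groupCohomology B n)) (A : Rep.{u} k G) :
    Subsingleton (groupCohomology A n) :=
  subsingleton_of_mulEquiv e A (h _)

/-- `Hⁿ⁺¹(G, Hom(k[X], N))` vanishes if the stabilizers have no cohomology in that degree. -/
theorem subsingleton_homRep_res_ofMulAction (θ : G →* K) (N : Rep.{u} k G)
    (h : ∀ x : X, Subsingleton (groupCohomology
      (Rep.res ((MulAction.stabilizer K x).comap θ).subtype N) (n + 1))) :
    Subsingleton (groupCohomology (homRep (Rep.res θ (Rep.ofMulAction k K X)) N) (n + 1)) := by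
  let : MulAction G X := MulAction.compHom X θ
  refine subsingleton_homRep_of_stabilizer (X := X)
    (fun x => (MonoidAlgebra.single x 1 : MonoidAlgebra k X))
    (fun g x => Representation.ofMulAction_single (θ g) x 1)
    (fun ψ => ⟨(MonoidAlgebra.basis X k).constr k ψ, fun x => ?_⟩)
    (fun φ hφ => (MonoidAlgebra.basis X k).ext fun x => ?_) fun x => h x
  · rw [← MonoidAlgebra.basis_apply, Module.Basis.constr_basis]
  · rw [MonoidAlgebra.basis_apply, hφ, LinearMap.zero_apply]

/-- Let `J` be the augmentation ideal of `k[X]` and let `G` act on `X` with a fixed point `a`. Then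
`Hⁿ⁺¹(G, Hom(J, N))` vanishes if the stabilizers of the other points have no cohomology in that
degree. -/
theorem subsingleton_homRep_augmentationIdeal (W : Submodule k (Rep.ofMulAction k K X))
    (hW : ∀ g, W ≤ W.comap ((Rep.ofMulAction k K X).ρ g))
    (ε : Rep.ofMulAction k K X →ₗ[k] k) (hε : ∀ x, ε (MonoidAlgebra.single x 1) = 1)
    (hker : ∀ m, m ∈ W ↔ ε m = 0) (θ : G →* K) (a : X) (ha : ∀ g, θ g • a = a)
    (N : Rep.{u} k G)
    (h : ∀ x : X, x ≠ a → Subsingleton (groupCohomology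
      (Rep.res ((MulAction.stabilizer K x).comap θ).subtype N) (n + 1))) :
    Subsingleton (groupCohomology
      (homRep (Rep.res θ (Rep.subrepresentation (Rep.ofMulAction k K X) W hW)) N) (n + 1)) := by
  let : MulAction G {x : X // x ≠ a} :=
    { smul := fun g x => ⟨θ g • x.1, fun hx => x.2
        (MulAction.injective (θ g) (hx.trans (ha g).symm))⟩
      one_smul := fun x => Subtype.ext (by
        change θ 1 • x.1 = x.1
        rw [map_one, one_smul])
      mul_smul := fun g g' x => Subtype.ext (by
        change θ (g * g') • x.1 = θ g • θ g' • x.1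
        rw [map_mul, mul_smul]) }
  let s : X → Rep.ofMulAction k K X := fun x => (MonoidAlgebra.single x 1 : MonoidAlgebra k X)
  have hs : ∀ g x, (Rep.ofMulAction k K X).ρ g (s x) = s (g • x) := fun g x =>
    Representation.ofMulAction_single g x 1
  have hext : ∀ Φ : Rep.ofMulAction k K X →ₗ[k] N, (∀ x, Φ (s x) = 0) → Φ = 0 := fun Φ hΦ =>
    (MonoidAlgebra.basis X k).ext fun x => by
      rw [MonoidAlgebra.basis_apply, LinearMap.zero_apply]
      exact hΦ x
  let b : X → W := fun x => ⟨s x - s a, (hker _).2 (by rw [map_sub, hε, hε, sub_self])⟩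
  refine subsingleton_homRep_of_stabilizer (X := {x : X // x ≠ a}) (fun x => b x.1)
    (fun g x => Subtype.ext ?_) (fun ψ => ?_) (fun φ hφ => ?_) fun x => ?_
  · change (Rep.ofMulAction k K X).ρ (θ g) (s x.1 - s a) = s (θ g • x.1) - s a
    rw [map_sub, hs, hs, ha]
  · classical
    let Φ : Rep.ofMulAction k K X →ₗ[k] N := (MonoidAlgebra.basis X k).constr k
      fun x => if hx : x = a then 0 else ψ ⟨x, hx⟩
    have hΦ : ∀ x, Φ (s x) = if hx : x = a then 0 else ψ ⟨x, hx⟩ := fun x => by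
      simp only [s, ← MonoidAlgebra.basis_apply]
      exact Module.Basis.constr_basis _ _ _ _
    refine ⟨Φ ∘ₗ W.subtype, fun x => ?_⟩
    change Φ (s x.1 - s a) = _
    rw [map_sub, hΦ, hΦ, dif_neg x.2, dif_pos rfl, sub_zero]
  -- The projection m ↦ m - ε(m) a onto W sends x to x - a, so a functional on W can be tested on
  -- the basis X.
  · let q : Rep.ofMulAction k K X →ₗ[k] W :=
      (LinearMap.id - LinearMap.smulRight ε (s a)).codRestrict W fun m => (hker _).2 (by
        change ε (m - ε m • s a) = 0
        rw [map_sub, map_smul, hε, smul_eq_mul, mul_one, sub_self])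
    have hq : ∀ m : W, q m = m := fun m => Subtype.ext (by
      change m.1 - ε m.1 • s a = m.1
      rw [(hker _).1 m.2, zero_smul, sub_zero])
    have hqs : ∀ x, q (s x) = b x := fun x => Subtype.ext (by
      change s x - ε (s x) • s a = s x - s a
      rw [hε, one_smul])
    have h0 : (φ : W →ₗ[k] N) ∘ₗ q = 0 := hext _ fun x => by
      change (φ : W →ₗ[k] N) (q (s x)) = 0
      rw [hqs]
      by_cases hx : x = a
      · have : b x = 0 := Subtype.ext (by simp [b, hx])
        rw [this, map_zero]
      · exact hφ ⟨x, hx⟩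
    refine LinearMap.ext fun m => ?_
    have := LinearMap.congr_fun h0 m.1
    change (φ : W →ₗ[k] N) (q m) = 0 at this
    rwa [hq] at this
  · have hst : MulAction.stabilizer G x = (MulAction.stabilizer K x.1).comap θ := by
      ext g
      exact Subtype.ext_iff
    rw [hst]
    exact h x.1 x.2

end PermutationVanishing

/-! ### Cohomological dimension and cyclic subgroups. -/

section Dimension

variable {G : Type} [Group G]

theorem subsingleton_of_cd_lt {n : ℕ} (h : cd G < n) (A : Rep.{0} ℤ G) :
    Subsingleton (groupCohomology A n) := by
  by_contra hA
  rw [not_subsingleton_iff_nontrivial] at hA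
  have hn : (n : ℕ∞) ≤ cd G := le_sSup ⟨n, rfl, A, hA⟩
  exact absurd hn (not_le.2 h)

theorem cd_le {d : ℕ} (h : ∀ n, d < n → ∀ A : Rep.{0} ℤ G, Subsingleton (groupCohomology A n)) :
    cd G ≤ d := by
  refine sSup_le ?_
  rintro _ ⟨n, rfl, A, hA⟩
  by_contra hn
  exact not_subsingleton_iff_nontrivial.2 hA (h n (by simpa using hn) A)

/-- A cyclic subgroup of a group of finite cohomological dimension is infinite or trivial, and
has cohomological dimension at most `1`. -/
theorem subsingleton_of_isCyclic {d : ℕ} (hd : cd G = d) (C : Subgroup G) [IsCyclic C]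
    [Nontrivial C] (n : ℕ) (A : Rep.{0} ℤ C) : Subsingleton (groupCohomology A (n + 2)) := by
  let e : C ≃* Multiplicative (ZMod (Nat.card C)) := (zmodCyclicMulEquiv ‹IsCyclic C›).symm
  obtain h | h := Nat.eq_zero_or_pos (Nat.card C)
  · rw [h] at e
    exact subsingleton_of_mulEquiv_of_forall e (fun B => subsingleton_of_infiniteCyclic B n) A
  · exfalso
    have hfin : Finite C := Nat.finite_of_card_ne_zero h.ne'
    have hne : NeZero (Nat.card C) := ⟨h.ne'⟩
    have hcard : Fintype.card (Multiplicative (ZMod (Nat.card C))) = Nat.card C := by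
      rw [Fintype.card_multiplicative, ZMod.card]
    have hnt := nontrivial_of_finiteCyclic (k := ℤ) (G := Multiplicative (ZMod (Nat.card C)))
      (by
        rw [hcard, Int.isUnit_iff]
        have := Finite.one_lt_card (α := C)
        -- The degree 2d + 2 is positive, even and greater than d; coinduction to G then contradicts
        -- cd(G) = d.
        omega) (2 * d + 2) ⟨d + 1, by ring⟩ (by omega)
    refine not_subsingleton_iff_nontrivial.2 hnt
      (subsingleton_of_mulEquiv_of_forall e.symm (fun B => ?_) _)
    rw [← subsingleton_coind]
    exact subsingleton_of_cd_lt (by rw [hd]; exact_mod_cast (by omega)) _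

end Dimension

/-! ### Stabilizers of the two-sided action, and the required vanishing. -/

section Main

variable {π : Type} [Group π]

theorem mem_stabilizer_twoSidedAction (a : π) (x : π × π) :
    x ∈ @MulAction.stabilizer (π × π) π _ (twoSidedAction π) a ↔ x.1 * a * x.2⁻¹ = a := Iff.rfl

/-- The homomorphism (g, h) ↦ (g, 1) factors through π, whose cohomology vanishes in degree d + 1;
the primitive found there is inflated along the first projection. -/
theorem isCoboundary_powCochain_fst {d : ℕ} (hd : cd π = d) :
    IsCoboundary ((canonicalTower ((MonoidHom.fst π π).prod 1)).V (d + 1)) := by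
  let j : π →* π × π := (MonoidHom.id π).prod 1
  have : Subsingleton (groupCohomology ((canonicalTower j).T (d + 1)) (d + 1)) :=
    subsingleton_of_cd_lt (by rw [hd]; exact_mod_cast Nat.lt_succ_self d) _
  obtain ⟨h, hh⟩ := exists_d_eq_of_subsingleton ((canonicalTower j).V (d + 1))
    ((canonicalTower j).d_V (d + 1))
  refine ⟨d, rfl, fun x => h fun i => (x i).1, fun x => ?_⟩
  have h1 := congrFun (d_res (MonoidHom.fst π π) h) x
  rw [hh] at h1
  exact h1.symm

/-- Through θ the group acts on π by left translation by the first factor, so every stabilizer is 1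
× π. -/
theorem subsingleton_homRep_fst {d n : ℕ} (hd : cd π = d) (hn : d < n) (θ : π × π →* π × π)
    (hθ : ∀ x, θ x = (x.1, 1)) (N : Rep.{0} ℤ (π × π)) :
    Subsingleton (groupCohomology (homRep (canonicalTower θ).P N) n) := by
  obtain ⟨n, rfl⟩ : ∃ n', n = n' + 1 := ⟨n - 1, by omega⟩
  let _ := twoSidedAction π
  refine subsingleton_homRep_res_ofMulAction (X := π) θ N fun a => ?_
  let S := (MulAction.stabilizer (π × π) a).comap θ
  have hS : ∀ x, x ∈ S ↔ x.1 = 1 := fun x => by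
    rw [Subgroup.mem_comap, mem_stabilizer_twoSidedAction, hθ]
    simp
  let e : S ≃* π :=
    { toFun := fun x => x.1.2
      invFun := fun h => ⟨(1, h), (hS _).2 rfl⟩
      left_inv := fun x => Subtype.ext (Prod.ext ((hS _).1 x.2).symm rfl)
      right_inv := fun h => rfl
      map_mul' := fun x y => rfl }
  exact subsingleton_of_mulEquiv_of_forall e
    (fun B => subsingleton_of_cd_lt (by rw [hd]; exact_mod_cast hn) B) _

/-- The cohomological dimension of `π × π` is at most twice that of `π`. -/
theorem cd_prod_self_le {d : ℕ} (hd : cd π = d) : cd (π × π) ≤ (2 * d : ℕ) :=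
  cd_le fun n hn A => (canonicalTower ((MonoidHom.fst π π).prod 1)).subsingleton_of_isCoboundary_V
    (by omega) (show d + 1 ≤ n by omega) (isCoboundary_powCochain_fst hd)
    (subsingleton_homRep_fst hd (by omega) _ (fun _ => rfl) A)
    -- Here s ≤ d and n > 2d, so n - s > d.
    fun s _ hs N => subsingleton_homRep_fst hd (by omega) _ (fun _ => rfl) _

/-- The stabilizer of a is the twisted diagonal {(aha⁻¹, h)}, isomorphic to π. -/
theorem subsingleton_homRep_id {d n : ℕ} (hd : cd π = d) (hn : d < n) (N : Rep.{0} ℤ (π × π)) :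
    Subsingleton (groupCohomology
      (homRep (canonicalTower (MonoidHom.id (π × π))).P N) n) := by
  obtain ⟨n, rfl⟩ : ∃ n', n = n' + 1 := ⟨n - 1, by omega⟩
  let _ := twoSidedAction π
  refine subsingleton_homRep_res_ofMulAction (X := π) (MonoidHom.id (π × π)) N fun a => ?_
  let S := (MulAction.stabilizer (π × π) a).comap (MonoidHom.id (π × π))
  have hS : ∀ x, x ∈ S ↔ x.1 = a * x.2 * a⁻¹ := fun x => by
    rw [Subgroup.mem_comap, mem_stabilizer_twoSidedAction, MonoidHom.id_apply,
      mul_inv_eq_iff_eq_mul, eq_mul_inv_iff_mul_eq]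
  let e : S ≃* π :=
    { toFun := fun x => x.1.2
      invFun := fun h => ⟨(a * h * a⁻¹, h), (hS _).2 rfl⟩
      left_inv := fun x => Subtype.ext (Prod.ext ((hS _).1 x.2).symm rfl)
      right_inv := fun h => rfl
      map_mul' := fun x y => rfl }
  exact subsingleton_of_mulEquiv_of_forall e
    (fun B => subsingleton_of_cd_lt (by rw [hd]; exact_mod_cast hn) B) _

/-- Two applications of Shapiro's lemma: first to the stabilizer S of a, then, since S fixes a, to I
with its permuted basis x - a. An element (g, a⁻¹ga) of S fixes x exactly when g commutes with xa⁻¹.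
-/
theorem subsingleton_homRep_homRep {d n : ℕ} (hd : cd π = d)
    (hcentraliser : ∀ g : π, g ≠ 1 → IsCyclic (Subgroup.centralizer ({g} : Set π)))
    (hn : 2 ≤ n) (N : Rep.{0} ℤ (π × π)) :
    Subsingleton (groupCohomology (homRep (canonicalTower (MonoidHom.id (π × π))).P
      (homRep (canonicalTower (MonoidHom.id (π × π))).J N)) n) := by
  obtain ⟨n, rfl⟩ : ∃ n', n = n' + 1 + 1 := ⟨n - 2, by omega⟩
  let _ := twoSidedAction π
  refine subsingleton_homRep_res_ofMulAction (X := π) (MonoidHom.id (π × π)) _ fun a => ?_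
  let S := (MulAction.stabilizer (π × π) a).comap (MonoidHom.id (π × π))
  have hS : ∀ x, x ∈ S ↔ x.1 = a * x.2 * a⁻¹ := fun x => by
    rw [Subgroup.mem_comap, mem_stabilizer_twoSidedAction, MonoidHom.id_apply,
      mul_inv_eq_iff_eq_mul, eq_mul_inv_iff_mul_eq]
  refine subsingleton_homRep_augmentationIdeal (X := π) (LinearMap.ker (augmentation π)) _
    (augmentation π) (fun x => ?_) (fun m => Iff.rfl) S.subtype a (fun g => g.2)
    (Rep.res S.subtype N) fun x hx => ?_
  · simp [augmentation]
  let Q := (MulAction.stabilizer (π × π) x).comap S.subtype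
  have hQ : ∀ y, y ∈ Q ↔ y.1.1 * x = x * y.1.2 := fun y => by
    rw [Subgroup.mem_comap, mem_stabilizer_twoSidedAction, Subgroup.subtype_apply,
      mul_inv_eq_iff_eq_mul]
  have hne : x * a⁻¹ ≠ 1 := fun h => hx (mul_inv_eq_one.1 h)
  let Z := Subgroup.centralizer ({x * a⁻¹} : Set π)
  have : IsCyclic Z := hcentraliser _ hne
  -- Nontriviality of the cyclic group Z, witnessed by xa⁻¹ itself, forces it to be infinite.
  have : Nontrivial Z := ⟨⟨⟨x * a⁻¹, Subgroup.mem_centralizer_singleton_iff.2 rfl⟩, 1,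
    fun h => hne (congrArg Subtype.val h)⟩⟩
  let e : Q ≃* Z :=
    { toFun := fun y => ⟨y.1.1.1, Subgroup.mem_centralizer_singleton_iff.2 (by
        have h1 := (hS _).1 y.1.2
        have h2 := (hQ _).1 y.2
        rw [← mul_assoc, h2, h1]
        group)⟩
      invFun := fun g => ⟨⟨(g.1, a⁻¹ * g.1 * a), (hS _).2 (by simp; group)⟩, (hQ _).2 (by
        have := Subgroup.mem_centralizer_singleton_iff.1 g.2
        change g.1 * x = x * (a⁻¹ * g.1 * a)
        rw [← mul_assoc, ← mul_assoc, ← this]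
        group)⟩
      left_inv := fun y => Subtype.ext (Subtype.ext (Prod.ext rfl (by
        have h1 := (hS _).1 y.1.2
        change a⁻¹ * y.1.1.1 * a = y.1.1.2
        rw [h1]
        group)))
      right_inv := fun g => rfl
      map_mul' := fun x y => rfl }
  exact subsingleton_of_mulEquiv_of_forall e (fun B => subsingleton_of_isCyclic hd Z n B) _

end Main

end CanonicalClass

end

theorem theorem4 (π : Type) [Group π]
    (hcentraliser : ∀ g : π, g ≠ 1 → IsCyclic (Subgroup.centralizer ({g} : Set π)))
    (hcd : CanonicalClass.cd π < CanonicalClass.cd (π × π)) :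
    ∃ n : ℕ, CanonicalClass.cd (π × π) = n ∧ CanonicalClass.canonicalClassPow π (n - 1) ≠ 0 := by
  open CanonicalClass in
  -- The strict inequality already forces cd(π) to be finite.
  obtain ⟨d, hd⟩ := ENat.ne_top_iff_exists.1 hcd.ne_top
  obtain ⟨n, hn⟩ := ENat.ne_top_iff_exists.1
    (ne_top_of_le_ne_top (ENat.natCast_ne_top _) (cd_prod_self_le hd.symm))
  refine ⟨n, hn.symm, fun hv => ?_⟩
  rw [← hd, ← hn, Nat.cast_lt] at hcd
  have hvan : ∀ A : Rep.{0} ℤ (π × π), Subsingleton (groupCohomology A n) := fun A =>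
    (canonicalTower (MonoidHom.id (π × π))).subsingleton_of_isCoboundary_V (m := n - 1)
      (by omega) (by omega) (isCoboundary_powCochain_of_eq_zero π hv)
      (subsingleton_homRep_id hd.symm hcd A)
      -- Since s < n - 1, the degree n - s is at least 2, the range in which infinite cyclic groups
      -- have no cohomology. Extracting an n-th factor would need degree 1, which is why the
      -- argument stops at 𝔳^{n-1}.
      fun s _ hs N => subsingleton_homRep_homRep hd.symm hcentraliser (by omega) N
  have hle : cd (π × π) ≤ (n - 1 : ℕ) := cd_le fun m hm A => by
    obtain rfl | hm' := (show n ≤ m by omega).eq_or_lt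
    · exact hvan A
    · exact subsingleton_of_cd_lt (by rw [← hn]; exact_mod_cast hm') A
  rw [← hn, Nat.cast_le] at hle
  omega
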